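/- An algorithm for simulating coins reads independent tosses of a coin one at a time, stops after a random number $N$ of tosses ($N$ is a stopping time of the sequence of tosses), and then declares heads or tails depending only on the first $N$ tosses. Let $\mathbf{P}_p$ be the law of an infinite sequence of i.i.d. tosses with probability of heads $p$. For $S\subseteq[0,1]$ and $f:S\to\mathbb{R}$, we say that $f$ has a fast simulation on $S$ if there is one algorithm (not depending on $p$) such that for every $p\in S$: $\mathbf{P}_p(N<\infty)=1$, the probability under $\mathbf{P}_p$ that heads is declared equals $f(p)$, and there are constants $C>0$ and $\rho\in[0,1)$, which may depend on $p$, with $\mathbf{P}_p(N>n)\le C\rho^n$ for all $n\ge 0$. **Theorem 2.** Let $I=[a,b]\subset(0,1)$ be a closed interval. If $f:I\to(0,1)$ is real analytic on $I$ (at every point of $I$, $f$ is given on a neighbourhood of the point in $I$ by a convergent power series), then $f$ has a fast simulation on $I$. Conversely, if $S\subseteq[0,1]$ and $f$ has a fast simulation on $S$, then $f$ is real analytic on every open set $U\subseteq S$. -/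

import Mathlib

open MeasureTheory

/-- The law `P_p` of an infinite sequence of independent tosses of a coin that shows heads
(`true`) with probability `p`. -/
noncomputable def coinLaw (p : unitInterval) : Measure (ℕ → Bool) :=
  Measure.infinitePi fun _ : ℕ => ProbabilityTheory.bernoulliMeasure true false p

/-- An algorithm that reads a sequence of coin tosses one by one, stops at some stopping time `N`
(with `N x = ⊤` if it never stops on `x`), and then declares heads (`true`) or tails (`false`)
depending on the tosses read so far. The first two fields are the number of tosses used and the
declared result; the laws say that the event `N = n` and the result on that event depend only
on the first `n` tosses. The value of `out` where `N = ⊤` is never used. -/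
structure CoinAlgorithm where
  N : (ℕ → Bool) → ℕ∞
  out : (ℕ → Bool) → Bool
  N_eq : ∀ (n : ℕ) (x y : ℕ → Bool), (∀ i < n, x i = y i) → N x = n → N y = n
  out_eq : ∀ (n : ℕ) (x y : ℕ → Bool), (∀ i < n, x i = y i) → N x = n → out y = out x

/-- The algorithm `A` simulates `f` on `S ⊆ [0, 1]`: for every `p ∈ S`, when it is fed with tosses
of a `p`-coin, it stops almost surely and declares heads with probability exactly `f p`. -/
def CoinAlgorithm.Simulates (A : CoinAlgorithm) (f : ℝ → ℝ) (S : Set ℝ) : Prop :=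
  ∀ p : unitInterval, (p : ℝ) ∈ S →
    (∀ᵐ x ∂(coinLaw p), A.N x ≠ ⊤) ∧
    (coinLaw p).real {x | A.N x ≠ ⊤ ∧ A.out x = true} = f p

/-- `f` has a fast simulation on `S ⊆ [0, 1]`: some algorithm simulates `f` on `S`, and for
every `p ∈ S` the number of tosses used has exponential tails under `P_p`. The constants may
depend on `p`, the algorithm may not. -/
def HasFastSimulation (f : ℝ → ℝ) (S : Set ℝ) : Prop :=
  ∃ A : CoinAlgorithm, A.Simulates f S ∧
    ∀ p : unitInterval, (p : ℝ) ∈ S →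
      ∃ C ρ : ℝ, 0 < C ∧ 0 ≤ ρ ∧ ρ < 1 ∧
        ∀ n : ℕ, (coinLaw p).real {x | (n : ℕ∞) < A.N x} ≤ C * ρ ^ n

/-!
A simulation algorithm is a pair of languages: the words after which heads, respectively tails, is
declared. That the algorithm stops at a well-defined time says that these languages form a prefix
family (`PrefixFamily`), probabilities are values of generating functions (`gf`), and exponential
tails say that the generating functions converge at weights slightly larger than those of the coin
(`FastOn`, `FastOn.hasFastSimulation`).

Fast simulation implies analyticity (`analyticOnNhd_of_hasFastSimulation`): if `f p` is the sum of
the probabilities `p ^ k * (1 - p) ^ (n - k)` of the words declaring heads, then replacing `p` by a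
nearby complex number multiplies a term by at most `κ ^ n` with `κ` close to `1`, which the tails
absorb. So the sum converges uniformly near `p` and is holomorphic.

Analyticity implies fast simulation (`fastOn_of_analyticOn`). Simulations compose (`FastOn.comp`),
because substituting languages for letters substitutes generating functions (`gf_subst`). Constant
coins, obtained from von Neumann's fair coin, allow the declaration to be randomized
(`fastOn_of_randomized`). This yields three families of simulated functions.

* Stopping at the first tails and randomizing according to the length of the run of heads gives
  `∑ θ n * x ^ n * (1 - x)` with `θ n ∈ [0, 1]`. By summation by parts this is every absolutely
  convergent power series, after an affine normalization (`exists_fastOn_powerSeries`).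
* Stopping at the first passage of a walk with negative drift gives multiplication by constants
  `C > 1` (`fastOn_linear`). By exchangeability, the conditional probability that the first toss
  shows heads, given the number of heads up to the passage time, is a known number that is at most
  `1 / C` if the walk starts high enough. Hence every nonconstant affine image of a simulated
  function is simulated as long as its values stay away from `0` and `1` (`FastOn.affine`).
* Repeating pairs of tosses until the two results agree squares the odds of a coin
  (`FastOn.pow_odds`).

Now extend `f` holomorphically to a neighbourhood of `[a, b]` (`exists_complex_extension`). It
contains a thin lens around `[a, b]` with tips `α < a` and `β > b` on the real axis
(`exists_lens`). The map `z ↦ ((z - α) / (β - z)) ^ k` takes the lens to the right half-plane, and a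
Cayley transform takes the latter to the unit disc, so `f` is a power series in the resulting
coordinate `u`. On the interval `u` is simulated: an affine function `v` of `p` has odds
`(p - α) / (β - p)`, these are raised to a power `k = 2 ^ j` and multiplied by a constant that makes
`u` positive, and `u` is an affine function of the coin with these odds
(`exists_fastOn_disc_coordinate`). Hence `f` is simulated as well.
-/

open scoped ENNReal

namespace CoinFactory

/-! ### Languages and their generating functions -/

section Words

variable {α β ι : Type*}

/-- The product of the weights of the letters of a word. -/
noncomputable def wordWeight (x : α → ℝ≥0∞) (w : List α) : ℝ≥0∞ := (w.map x).prod

/-- The generating function of a language `L`, evaluated at the letter weights `x`. It takes values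
in `[0, ∞]`, so that no question of summability arises. -/
noncomputable def gf (x : α → ℝ≥0∞) (L : Set (List α)) : ℝ≥0∞ := ∑' w : L, wordWeight x w.1

/-- A family of languages is a prefix family if no word of any of them is a proper prefix of a word
of any other, and the languages are disjoint: a reader of letters who stops at the first word
belonging to one of the languages knows which language it is. -/
def PrefixFamily (c : ι → Set (List α)) : Prop :=
  ∀ a b, ∀ u ∈ c a, ∀ v ∈ c b, u <+: v → a = b ∧ u = v

/-- A language none of whose words is a proper prefix of another one. -/
def PrefixFree (L : Set (List α)) : Prop := ∀ u ∈ L, ∀ v ∈ L, u <+: v → u = v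

@[simp] lemma wordWeight_nil (x : α → ℝ≥0∞) : wordWeight x [] = 1 := by simp [wordWeight]

@[simp] lemma wordWeight_cons (x : α → ℝ≥0∞) (a : α) (w : List α) :
    wordWeight x (a :: w) = x a * wordWeight x w := by simp [wordWeight]

@[simp] lemma wordWeight_append (x : α → ℝ≥0∞) (u v : List α) :
    wordWeight x (u ++ v) = wordWeight x u * wordWeight x v := by simp [wordWeight]

@[simp] lemma wordWeight_replicate (x : α → ℝ≥0∞) (n : ℕ) (a : α) :
    wordWeight x (List.replicate n a) = x a ^ n := by simp [wordWeight]

lemma wordWeight_mono {x y : α → ℝ≥0∞} (h : ∀ a, x a ≤ y a) (w : List α) :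
    wordWeight x w ≤ wordWeight y w := by
  induction w with
  | nil => simp
  | cons a w ih => simpa using mul_le_mul' (h a) ih

lemma wordWeight_mul (s : ℝ≥0∞) (x : α → ℝ≥0∞) (w : List α) :
    wordWeight (fun a => s * x a) w = s ^ w.length * wordWeight x w := by
  induction w with
  | nil => simp
  | cons a w ih => simp only [wordWeight_cons, ih, List.length_cons, pow_succ]; ring

lemma gf_mono {x y : α → ℝ≥0∞} (h : ∀ a, x a ≤ y a) (L : Set (List α)) : gf x L ≤ gf y L :=
  ENNReal.tsum_le_tsum fun w => wordWeight_mono h w.1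

@[simp] lemma gf_empty (x : α → ℝ≥0∞) : gf x ∅ = 0 := by simp [gf]

@[simp] lemma gf_singleton (x : α → ℝ≥0∞) (w : List α) : gf x {w} = wordWeight x w := by
  simp only [gf]
  rw [tsum_singleton (f := wordWeight x)]

lemma gf_union (x : α → ℝ≥0∞) {L M : Set (List α)} (h : Disjoint L M) :
    gf x (L ∪ M) = gf x L + gf x M :=
  ENNReal.summable.tsum_union_disjoint h ENNReal.summable

lemma gf_range (x : α → ℝ≥0∞) {g : ι → List α} (hg : Function.Injective g) :
    gf x (Set.range g) = ∑' i, wordWeight x (g i) :=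
  tsum_range (wordWeight x) hg

lemma gf_image (x : α → ℝ≥0∞) {g : ι → List α} (s : Set ι) (hg : Set.InjOn g s) :
    gf x (g '' s) = ∑' i : s, wordWeight x (g i) :=
  tsum_image (wordWeight x) hg

lemma gf_cons (x : α → ℝ≥0∞) (a : α) (L : Set (List α)) :
    gf x (List.cons a '' L) = x a * gf x L := by
  rw [gf_image x L (fun u _ v _ h => by simpa using h)]
  simp [gf, ENNReal.tsum_mul_left]

/-- A bound on the words of bounded length is a bound on the generating function. -/
lemma gf_le_of_length_le {x : α → ℝ≥0∞} {L : Set (List α)} {K : ℝ≥0∞}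
    (h : ∀ n, gf x {w ∈ L | w.length ≤ n} ≤ K) : gf x L ≤ K := by
  classical
  rw [gf, ENNReal.tsum_eq_iSup_sum]
  refine iSup_le fun F => ?_
  refine le_trans ?_ (h (F.sup fun w => w.1.length))
  have hF : ∀ w ∈ F, w.1.length ≤ F.sup fun w => w.1.length :=
    fun w hw => Finset.le_sup (f := fun w : L => w.1.length) hw
  rw [gf, tsum_subtype {w ∈ L | w.length ≤ F.sup fun w => w.1.length} (wordWeight x)]
  refine le_trans (le_of_eq ?_) (ENNReal.sum_le_tsum (F.image Subtype.val))
  rw [Finset.sum_image (by simp)]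
  refine Finset.sum_congr rfl fun w hw => ?_
  rw [Set.indicator_of_mem]
  exact ⟨w.2, hF w hw⟩

lemma PrefixFree.append_inj {L : Set (List α)} (hL : PrefixFree L) {u u' v v' : List α}
    (hu : u ∈ L) (hu' : u' ∈ L) (h : u ++ v = u' ++ v') : u = u' ∧ v = v' := by
  have key : u = u' := by
    rcases List.prefix_or_prefix_of_prefix (List.prefix_append u v)
      (h ▸ List.prefix_append u' v') with h1 | h1
    · exact hL u hu u' hu' h1
    · exact (hL u' hu' u hu h1).symm
  subst key
  exact ⟨rfl, by simpa using h⟩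

/-- The words formed by a word `u` of `L` followed by a word of the language `K u`. -/
def bind (L : Set (List α)) (K : List α → Set (List α)) : Set (List α) :=
  {w | ∃ u ∈ L, ∃ v ∈ K u, w = u ++ v}

/-- Running a second procedure after a first one multiplies the weights. -/
lemma gf_bind (x : α → ℝ≥0∞) {L : Set (List α)} (hL : PrefixFree L)
    (K : List α → Set (List α)) :
    gf x (bind L K) = ∑' u : L, wordWeight x u.1 * gf x (K u.1) := by
  let e : (Σ u : L, K u.1) → bind L K :=
    fun z => ⟨z.1.1 ++ z.2.1, z.1.1, z.1.2, z.2.1, z.2.2, rfl⟩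
  have he : Function.Bijective e := by
    constructor
    · rintro ⟨⟨u, hu⟩, ⟨v, hv⟩⟩ ⟨⟨u', hu'⟩, ⟨v', hv'⟩⟩ h
      have h' : u ++ v = u' ++ v' := congrArg Subtype.val h
      obtain ⟨rfl, rfl⟩ := hL.append_inj hu hu' h'
      rfl
    · rintro ⟨w, u, hu, v, hv, rfl⟩
      exact ⟨⟨⟨u, hu⟩, ⟨v, hv⟩⟩, rfl⟩
  rw [gf, ← (Equiv.ofBijective e he).tsum_eq, ENNReal.tsum_sigma']
  refine tsum_congr fun u => ?_
  rw [gf, ← ENNReal.tsum_mul_left]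
  refine tsum_congr fun v => ?_
  simp [e]

lemma PrefixFamily.prefixFree {c : ι → Set (List α)} (hc : PrefixFamily c) (a : ι) :
    PrefixFree (c a) := fun u hu v hv h => (hc a a u hu v hv h).2

lemma PrefixFamily.prefixFree_iUnion {c : ι → Set (List α)} (hc : PrefixFamily c) :
    PrefixFree (⋃ a, c a) := by
  intro u hu v hv h
  obtain ⟨a, ha⟩ := Set.mem_iUnion.1 hu
  obtain ⟨b, hb⟩ := Set.mem_iUnion.1 hv
  exact (hc a b u ha v hb h).2

lemma PrefixFamily.disjoint {c : ι → Set (List α)} (hc : PrefixFamily c) {a b : ι} (h : a ≠ b) :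
    Disjoint (c a) (c b) :=
  Set.disjoint_left.2 fun u hu hu' => h (hc a b u hu u hu' List.prefix_rfl).1

lemma PrefixFamily.bind {L : Set (List α)} (hL : PrefixFree L)
    {K : List α → ι → Set (List α)} (hK : ∀ u ∈ L, PrefixFamily (K u)) :
    PrefixFamily fun i => CoinFactory.bind L fun u => K u i := by
  rintro a b _ ⟨u, hu, v, hv, rfl⟩ _ ⟨u', hu', v', hv', rfl⟩ ⟨z, hz⟩
  rw [List.append_assoc] at hz
  obtain ⟨rfl, hvz⟩ := hL.append_inj hu hu' hz
  obtain ⟨h1, rfl⟩ := hK u hu a b v hv v' hv' ⟨z, hvz⟩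
  exact ⟨h1, rfl⟩

/-- The language of all words obtained from `w` by replacing every letter `a` with a word
of `c a`. -/
def substWord (c : α → Set (List β)) : List α → Set (List β)
  | [] => {[]}
  | a :: w => CoinFactory.bind (c a) fun _ => substWord c w

/-- The language obtained from `L` by replacing every letter `a` with an arbitrary word
of `c a`. -/
def subst (c : α → Set (List β)) (L : Set (List α)) : Set (List β) :=
  {w | ∃ u ∈ L, w ∈ substWord c u}

lemma gf_substWord (x : β → ℝ≥0∞) {c : α → Set (List β)} (hc : PrefixFamily c) (u : List α) :
    gf x (substWord c u) = wordWeight (fun a => gf x (c a)) u := by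
  induction u with
  | nil => simp [substWord]
  | cons a u ih =>
    rw [substWord, gf_bind x (hc.prefixFree a)]
    simp only [ih, wordWeight_cons, ENNReal.tsum_mul_right]
    rfl

lemma prefix_of_substWord {c : α → Set (List β)} (hc : PrefixFamily c) :
    ∀ (u u' : List α) (w w' : List β), w ∈ substWord c u → w' ∈ substWord c u' → w <+: w' →
      (u <+: u' ∨ u' <+: u) ∧ (u = u' → w = w')
  | [], [], w, w', hw, hw', _ => by
    simp only [substWord, Set.mem_singleton_iff] at hw hw'
    simp [hw, hw']
  | [], _ :: _, _, _, _, _, _ => by simp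
  | _ :: _, [], _, _, _, _, _ => by simp
  | a :: u, a' :: u', _, _, ⟨h, hh, r, hr, rfl⟩, ⟨h', hh', r', hr', rfl⟩, ⟨z, hz⟩ => by
    rw [List.append_assoc] at hz
    have ha : a = a' ∧ h = h' := by
      rcases List.prefix_or_prefix_of_prefix (List.prefix_append h (r ++ z))
        (hz ▸ List.prefix_append h' r') with h1 | h1
      · exact hc _ _ _ hh _ hh' h1
      · have := hc _ _ _ hh' _ hh h1
        exact ⟨this.1.symm, this.2.symm⟩
    obtain ⟨rfl, rfl⟩ := ha
    have := prefix_of_substWord hc u u' r r' hr hr' ⟨z, by simpa using hz⟩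
    simpa using this

lemma PrefixFamily.subst {c : α → Set (List β)} (hc : PrefixFamily c)
    {d : ι → Set (List α)} (hd : PrefixFamily d) :
    PrefixFamily fun i => CoinFactory.subst c (d i) := by
  rintro a b w ⟨u, hu, hw⟩ w' ⟨u', hu', hw'⟩ h
  obtain ⟨h1, h2⟩ := prefix_of_substWord hc u u' w w' hw hw' h
  have hab : a = b ∧ u = u' := by
    rcases h1 with h1 | h1
    · exact hd _ _ _ hu _ hu' h1
    · have := hd _ _ _ hu' _ hu h1
      exact ⟨this.1.symm, this.2.symm⟩
  exact ⟨hab.1, h2 hab.2⟩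

/-- Substitution of languages for letters is substitution of generating functions: a procedure that
is fed with the results of another procedure. -/
lemma gf_subst (x : β → ℝ≥0∞) {c : α → Set (List β)} (hc : PrefixFamily c)
    {L : Set (List α)} (hL : PrefixFree L) :
    gf x (subst c L) = gf (fun a => gf x (c a)) L := by
  let e : (Σ u : L, substWord c u.1) → subst c L :=
    fun z => ⟨z.2.1, z.1.1, z.1.2, z.2.2⟩
  have he : Function.Bijective e := by
    constructor
    · rintro ⟨⟨u, hu⟩, ⟨v, hv⟩⟩ ⟨⟨u', hu'⟩, ⟨v', hv'⟩⟩ h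
      have h' : v = v' := congrArg Subtype.val h
      subst h'
      have : u = u' := by
        rcases (prefix_of_substWord hc u u' v v hv hv' List.prefix_rfl).1 with h1 | h1
        · exact hL _ hu _ hu' h1
        · exact (hL _ hu' _ hu h1).symm
      subst this
      rfl
    · rintro ⟨w, u, hu, hw⟩
      exact ⟨⟨⟨u, hu⟩, ⟨w, hw⟩⟩, rfl⟩
  rw [gf, ← (Equiv.ofBijective e he).tsum_eq, ENNReal.tsum_sigma']
  refine tsum_congr fun u => ?_
  rw [← gf_substWord x hc]
  simp [e, gf]

end Words

/-! ### Fast simulation by prefix families -/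

/-- The weights of heads and tails for a coin that shows heads with probability `p`. -/
noncomputable def coin (p : ℝ) : Bool → ℝ≥0∞ := fun b => ENNReal.ofReal (if b then p else 1 - p)

@[simp] lemma coin_true (p : ℝ) : coin p true = ENNReal.ofReal p := rfl

@[simp] lemma coin_false (p : ℝ) : coin p false = ENNReal.ofReal (1 - p) := by simp [coin]

lemma coin_ne_top (p : ℝ) (b : Bool) : coin p b ≠ ⊤ := ENNReal.ofReal_ne_top

lemma coin_ne_zero {p : ℝ} (hp : p ∈ Set.Ioo (0 : ℝ) 1) (b : Bool) : coin p b ≠ 0 := by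
  cases b <;> simp [hp.1, hp.2]

/-- Fast simulation in terms of words: `c true` and `c false` are the words after which heads,
respectively tails, is declared. Exponential tails are expressed by the convergence of the generating
functions at weights exceeding those of the coin by a factor `s > 1`. All values are required to lie
strictly between `0` and `1`. -/
def FastOn (f : ℝ → ℝ) (S : Set ℝ) : Prop :=
  ∃ c : Bool → Set (List Bool), PrefixFamily c ∧ ∀ p ∈ S,
    p ∈ Set.Ioo (0 : ℝ) 1 ∧ f p ∈ Set.Ioo (0 : ℝ) 1 ∧
    (∀ b, gf (coin p) (c b) = coin (f p) b) ∧
    ∃ s : ℝ≥0∞, 1 < s ∧ ∀ b, gf (fun a => s * coin p a) (c b) ≠ ⊤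

lemma FastOn.mono {f : ℝ → ℝ} {S T : Set ℝ} (h : FastOn f S) (hT : T ⊆ S) : FastOn f T := by
  obtain ⟨c, hc, h⟩ := h
  exact ⟨c, hc, fun p hp => h p (hT hp)⟩

lemma FastOn.mem_Ioo {f : ℝ → ℝ} {S : Set ℝ} (h : FastOn f S) {p : ℝ} (hp : p ∈ S) :
    f p ∈ Set.Ioo (0 : ℝ) 1 := by
  obtain ⟨c, hc, h⟩ := h
  exact (h p hp).2.1

lemma FastOn.congr {f g : ℝ → ℝ} {S : Set ℝ} (h : FastOn f S) (hfg : ∀ p ∈ S, g p = f p) :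
    FastOn g S := by
  obtain ⟨c, hc, h⟩ := h
  refine ⟨c, hc, fun p hp => ?_⟩
  rw [hfg p hp]
  exact h p hp

/-- Exchange heads and tails in the output. -/
lemma FastOn.one_sub {f : ℝ → ℝ} {S : Set ℝ} (h : FastOn f S) :
    FastOn (fun p => 1 - f p) S := by
  obtain ⟨c, hc, h⟩ := h
  refine ⟨fun b => c (!b), fun a b u hu v hv huv => ?_, fun p hp => ?_⟩
  · have := hc _ _ u hu v hv huv
    exact ⟨by simpa using this.1, this.2⟩
  · obtain ⟨h1, h2, h3, s, hs, h4⟩ := h p hp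
    refine ⟨h1, ⟨by linarith [h2.2], by linarith [h2.1]⟩, fun b => ?_, s, hs, fun b => h4 _⟩
    rw [h3]
    cases b <;> simp

/-- A generating function with positive value that converges slightly beyond a point is right
continuous there along the ray: a power `((1 - δ) + δ s) ^ n` is at most `(1 - δ) + δ s ^ n`. -/
lemma exists_gf_le {α : Type*} {x : α → ℝ≥0∞} {L : Set (List α)} {s s₁ : ℝ≥0∞} (hs : 1 < s)
    (hs₁ : 1 < s₁) (h0 : gf x L ≠ 0) (hL : gf (fun a => s * x a) L ≠ ⊤) :
    ∃ t : ℝ≥0∞, 1 < t ∧ gf (fun a => t * x a) L ≤ s₁ * gf x L := by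
  set v := gf x L with hv
  set K := gf (fun a => s * x a) L with hK
  set δ : ℝ≥0∞ := min (1 / 2) ((s₁ - 1) * v / (K + 1)) with hδ
  have hK1 : K + 1 ≠ ⊤ := by simp [hL]
  have hδ1 : δ ≤ 1 / 2 := min_le_left _ _
  have hδ1' : δ ≤ 1 := hδ1.trans (by simp)
  have hδt : δ ≠ ⊤ := ne_top_of_le_ne_top (by simp) hδ1'
  have hδ0 : δ ≠ 0 := by
    have h1 : 0 < (s₁ - 1) * v / (K + 1) :=
      ENNReal.div_pos (mul_ne_zero (tsub_pos_of_lt hs₁).ne' h0) hK1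
    have : 0 < δ := lt_min (by simp) h1
    exact this.ne'
  have hδK : δ * K ≤ (s₁ - 1) * v := by
    calc δ * K ≤ (s₁ - 1) * v / (K + 1) * (K + 1) := by
          gcongr
          · exact min_le_right _ _
          · exact le_self_add
      _ ≤ (s₁ - 1) * v := (ENNReal.div_mul_cancel (by simp) hK1).le
  have hsum : (1 - δ) + δ = 1 := tsub_add_cancel_of_le hδ1'
  refine ⟨(1 - δ) + δ * s, ?_, ?_⟩
  · calc (1 : ℝ≥0∞) = (1 - δ) + δ * 1 := by rw [mul_one, hsum]
      _ < (1 - δ) + δ * s := by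
        refine ENNReal.add_lt_add_left (by simp) ?_
        exact (ENNReal.mul_lt_mul_iff_right hδ0 hδt).2 hs
  · have hpow : ∀ n : ℕ, ((1 - δ) + δ * s) ^ n ≤ (1 - δ) + δ * s ^ n := by
      intro n
      rcases Nat.eq_zero_or_pos n with rfl | hn
      · simp [hsum]
      · have := ENNReal.rpow_arith_mean_le_arith_mean2_rpow (1 - δ) δ 1 s hsum
          (p := n) (by exact_mod_cast hn)
        simpa using this
    calc gf (fun a => ((1 - δ) + δ * s) * x a) L
        ≤ ∑' w : L, ((1 - δ) * wordWeight x w.1 + δ * wordWeight (fun a => s * x a) w.1) := by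
          refine ENNReal.tsum_le_tsum fun w => ?_
          rw [wordWeight_mul, wordWeight_mul, ← mul_assoc, ← add_mul]
          gcongr
          exact hpow _
      _ = (1 - δ) * v + δ * K := by
          rw [ENNReal.tsum_add, ENNReal.tsum_mul_left, ENNReal.tsum_mul_left]
          rfl
      _ ≤ 1 * v + (s₁ - 1) * v := by
          gcongr
          exact tsub_le_self
      _ = s₁ * v := by rw [← add_mul, add_tsub_cancel_of_le hs₁.le]

/-- Feeding an algorithm with coins that are themselves simulated. -/
lemma FastOn.comp {f g : ℝ → ℝ} {S T : Set ℝ} (hf : FastOn f T) (hg : FastOn g S)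
    (hST : ∀ p ∈ S, g p ∈ T) : FastOn (fun p => f (g p)) S := by
  obtain ⟨d, hd, hf⟩ := hf
  obtain ⟨c, hc, hg⟩ := hg
  refine ⟨fun b => subst c (d b), hc.subst hd, fun p hp => ?_⟩
  obtain ⟨h1, h2, h3, s, hs, h4⟩ := hg p hp
  obtain ⟨-, h6, h7, s₁, hs₁, h8⟩ := hf (g p) (hST p hp)
  refine ⟨h1, h6, fun b => ?_, ?_⟩
  · rw [gf_subst _ hc (hd.prefixFree b), ← h7 b]
    exact congrArg (fun x => gf x (d b)) (funext h3)
  · have key : ∀ b, ∃ t : ℝ≥0∞, 1 < t ∧ gf (fun a => t * coin p a) (c b) ≤ s₁ * coin (g p) b := by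
      intro b
      have h0 : gf (coin p) (c b) ≠ 0 := by rw [h3]; exact coin_ne_zero h2 b
      have := exists_gf_le hs hs₁ h0 (h4 b)
      rwa [h3] at this
    choose t ht1 ht2 using key
    refine ⟨min (t true) (t false), lt_min (ht1 _) (ht1 _), fun b => ?_⟩
    rw [gf_subst _ hc (hd.prefixFree b)]
    refine ne_top_of_le_ne_top (h8 b) (gf_mono (fun a => ?_) _)
    refine le_trans (gf_mono (fun a' => ?_) _) (ht2 a)
    gcongr
    cases a
    · exact min_le_right _ _
    · exact min_le_left _ _

/-! ### Loops, fair coins and constants -/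

lemma prefix_loop {α : Type*} {a t t' : α} (ht : t ≠ a) (ht' : t' ≠ a) :
    ∀ n m : ℕ, List.replicate n a ++ [t] <+: List.replicate m a ++ [t'] → n = m ∧ t = t'
  | 0, 0, h => by simpa using h
  | 0, m + 1, h => by simp [List.replicate_succ, ht] at h
  | n + 1, 0, h => by
    simp only [List.replicate_succ, List.cons_append, List.replicate_zero, List.nil_append,
      List.cons_prefix_cons] at h
    exact absurd h.1.symm ht'
  | n + 1, m + 1, h => by
    simp only [List.replicate_succ, List.cons_append, List.cons_prefix_cons, true_and] at h
    simpa using prefix_loop ht ht' n m h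

lemma loop_injective {α : Type*} {a t : α} (ht : t ≠ a) :
    Function.Injective fun n : ℕ => List.replicate n a ++ [t] := fun n m h =>
  (prefix_loop ht ht n m ⟨[], by simpa using h⟩).1

/-- The words over `Option Bool` in which `some b` is the first letter different from `none`: an
experiment is repeated until its outcome is not `none`, and the final outcome is `b`. -/
def loop (b : Bool) : Set (List (Option Bool)) :=
  Set.range fun n : ℕ => List.replicate n none ++ [some b]

lemma prefixFamily_loop : PrefixFamily loop := by
  rintro a b _ ⟨n, rfl⟩ _ ⟨m, rfl⟩ h
  obtain ⟨rfl, hab⟩ := prefix_loop (by simp) (by simp) n m h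
  obtain rfl := Option.some.inj hab
  exact ⟨rfl, rfl⟩

lemma gf_loop (x : Option Bool → ℝ≥0∞) (b : Bool) :
    gf x (loop b) = (1 - x none)⁻¹ * x (some b) := by
  rw [loop, gf_range x (loop_injective (by simp))]
  simp [ENNReal.tsum_mul_right, ENNReal.tsum_geometric]

lemma gf_subst_loop {c : Option Bool → Set (List Bool)} (hc : PrefixFamily c)
    (x : Bool → ℝ≥0∞) (b : Bool) :
    gf x (subst c (loop b)) = (1 - gf x (c none))⁻¹ * gf x (c (some b)) := by
  rw [gf_subst x hc (prefixFamily_loop.prefixFree b), gf_loop]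

/-- Von Neumann's classification of pairs of tosses. -/
def unequalPair : Option Bool → Set (List Bool)
  | none => {[true, true]} ∪ {[false, false]}
  | some true => {[true, false]}
  | some false => {[false, true]}

/-- The classification of pairs of tosses that keeps the pairs of equal tosses. -/
def equalPair : Option Bool → Set (List Bool)
  | none => {[true, false]} ∪ {[false, true]}
  | some b => {[b, b]}

lemma prefixFamily_unequalPair : PrefixFamily unequalPair := by
  rintro (_ | _ | _) (_ | _ | _) u hu v hv h <;>
  simp only [unequalPair, Set.mem_union, Set.mem_singleton_iff] at hu hv <;>
  (try rcases hu with rfl | rfl) <;> (try rcases hv with rfl | rfl) <;> simp at h ⊢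

lemma prefixFamily_equalPair : PrefixFamily equalPair := by
  rintro (_ | _ | _) (_ | _ | _) u hu v hv h <;>
  simp only [equalPair, Set.mem_union, Set.mem_singleton_iff] at hu hv <;>
  (try rcases hu with rfl | rfl) <;> (try rcases hv with rfl | rfl) <;> simp at h ⊢

lemma gf_unequalPair_none (x : Bool → ℝ≥0∞) :
    gf x (unequalPair none) = x true * x true + x false * x false := by
  rw [unequalPair, gf_union _ (by simp)]
  simp

lemma gf_unequalPair_some (x : Bool → ℝ≥0∞) (b : Bool) :
    gf x (unequalPair (some b)) = x true * x false := by
  cases b <;> simp [unequalPair, mul_comm]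

lemma gf_equalPair_none (x : Bool → ℝ≥0∞) :
    gf x (equalPair none) = x true * x false + x false * x true := by
  rw [equalPair, gf_union _ (by simp)]
  simp

lemma gf_equalPair_some (x : Bool → ℝ≥0∞) (b : Bool) :
    gf x (equalPair (some b)) = x b * x b := by
  simp [equalPair]

lemma inv_one_sub_ofReal_mul {r : ℝ} (h0 : 0 ≤ r) (h1 : r < 1) (t : ℝ) :
    (1 - ENNReal.ofReal r)⁻¹ * ENNReal.ofReal t = ENNReal.ofReal (t / (1 - r)) := by
  rw [← ENNReal.ofReal_one, ← ENNReal.ofReal_sub _ h0, ENNReal.ofReal_div_of_pos (by linarith),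
    ENNReal.div_eq_inv_mul]

lemma exists_sq_mul_lt_one {r : ℝ} (h0 : 0 ≤ r) (h1 : r < 1) :
    ∃ s : ℝ, 1 < s ∧ s * s * r < 1 := by
  refine ⟨1 + (1 - r) / 4, by linarith, ?_⟩
  nlinarith [mul_nonneg h0 (sub_nonneg.2 h1.le)]

/-- The procedure that repeats pairs of tosses classified by `c` has exponential tails as soon as
the probability of repetition is less than `1`. -/
lemma exists_gf_subst_loop_ne_top {c : Option Bool → Set (List Bool)} (hc : PrefixFamily c)
    (hlen : ∀ i, ∀ w ∈ c i, w.length = 2) {p r : ℝ} (h0 : 0 ≤ r) (h1 : r < 1)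
    (hr : gf (coin p) (c none) = ENNReal.ofReal r)
    (ht : ∀ b, gf (coin p) (c (some b)) ≠ ⊤) :
    ∃ s : ℝ≥0∞, 1 < s ∧ ∀ b, gf (fun a => s * coin p a) (subst c (loop b)) ≠ ⊤ := by
  obtain ⟨s, hs, hsr⟩ := exists_sq_mul_lt_one h0 h1
  refine ⟨ENNReal.ofReal s, by simpa using hs, fun b => ?_⟩
  have hscale : ∀ i, gf (fun a => ENNReal.ofReal s * coin p a) (c i)
      = ENNReal.ofReal (s * s) * gf (coin p) (c i) := by
    intro i
    rw [gf, gf, ← ENNReal.tsum_mul_left]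
    refine tsum_congr fun w => ?_
    rw [wordWeight_mul, hlen i _ w.2, ENNReal.ofReal_mul (by linarith), sq]
  rw [gf_subst_loop hc, hscale, hscale, hr, ← ENNReal.ofReal_mul (by nlinarith)]
  refine ENNReal.mul_ne_top (ENNReal.inv_ne_top.2 ?_)
    (ENNReal.mul_ne_top ENNReal.ofReal_ne_top (ht b))
  have : ENNReal.ofReal (s * s * r) < 1 := by simpa using hsr
  exact (tsub_pos_of_lt this).ne'

lemma length_unequalPair : ∀ i, ∀ w ∈ unequalPair i, w.length = 2 := by
  rintro (_ | _ | _) w hw <;>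
  simp only [unequalPair, Set.mem_union, Set.mem_singleton_iff] at hw <;>
  (try rcases hw with rfl | rfl) <;> rfl

lemma length_equalPair : ∀ i, ∀ w ∈ equalPair i, w.length = 2 := by
  rintro (_ | _ | _) w hw <;>
  simp only [equalPair, Set.mem_union, Set.mem_singleton_iff] at hw <;>
  (try rcases hw with rfl | rfl) <;> rfl

/-- Von Neumann's fair coin. -/
def fair (b : Bool) : Set (List Bool) := subst unequalPair (loop b)

lemma prefixFamily_fair : PrefixFamily fair :=
  prefixFamily_unequalPair.subst prefixFamily_loop

lemma gf_coin_unequalPair_none {p : ℝ} (hp : p ∈ Set.Ioo (0 : ℝ) 1) :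
    gf (coin p) (unequalPair none) = ENNReal.ofReal (p * p + (1 - p) * (1 - p)) := by
  have h1 := hp.1
  have h2 : 0 < 1 - p := by linarith [hp.2]
  rw [gf_unequalPair_none, coin_true, coin_false, ← ENNReal.ofReal_mul h1.le,
    ← ENNReal.ofReal_mul h2.le, ← ENNReal.ofReal_add (by positivity) (by positivity)]

lemma gf_coin_fair {p : ℝ} (hp : p ∈ Set.Ioo (0 : ℝ) 1) (b : Bool) :
    gf (coin p) (fair b) = ENNReal.ofReal (1 / 2) := by
  have h1 := hp.1
  have h2 : 0 < 1 - p := by linarith [hp.2]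
  rw [fair, gf_subst_loop prefixFamily_unequalPair, gf_coin_unequalPair_none hp,
    gf_unequalPair_some, coin_true, coin_false, ← ENNReal.ofReal_mul h1.le,
    inv_one_sub_ofReal_mul (by positivity) (by nlinarith)]
  congr 1
  have : 1 - (p * p + (1 - p) * (1 - p)) = 2 * (p * (1 - p)) := by ring
  rw [this]
  field_simp

lemma exists_gf_fair_ne_top {p : ℝ} (hp : p ∈ Set.Ioo (0 : ℝ) 1) :
    ∃ s : ℝ≥0∞, 1 < s ∧ ∀ b, gf (fun a => s * coin p a) (fair b) ≠ ⊤ := by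
  have h1 := hp.1
  have h2 : 0 < 1 - p := by linarith [hp.2]
  refine exists_gf_subst_loop_ne_top prefixFamily_unequalPair length_unequalPair
    (r := p * p + (1 - p) * (1 - p)) (by positivity) (by nlinarith)
    (gf_coin_unequalPair_none hp) fun b => ?_
  rw [gf_unequalPair_some]
  exact ENNReal.mul_ne_top (coin_ne_top _ _) (coin_ne_top _ _)

/-- The coin with odds `(p / (1 - p)) ^ 2`: toss twice until the results agree. -/
lemma fastOn_sq_odds :
    FastOn (fun p => p * p / (p * p + (1 - p) * (1 - p))) (Set.Ioo 0 1) := by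
  refine ⟨fun b => subst equalPair (loop b),
    prefixFamily_equalPair.subst prefixFamily_loop, fun p hp => ?_⟩
  have h1 := hp.1
  have h2 : 0 < 1 - p := by linarith [hp.2]
  have hnone : gf (coin p) (equalPair none) = ENNReal.ofReal (2 * (p * (1 - p))) := by
    rw [gf_equalPair_none, coin_true, coin_false, ← ENNReal.ofReal_mul h1.le,
      ← ENNReal.ofReal_mul h2.le, ← ENNReal.ofReal_add (by positivity) (by positivity)]
    congr 1
    ring
  have hlt : 2 * (p * (1 - p)) < 1 := by nlinarith [sq_nonneg (p - (1 - p)), mul_pos h1 h2]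
  have hden : 1 - 2 * (p * (1 - p)) = p * p + (1 - p) * (1 - p) := by ring
  refine ⟨hp, ⟨by positivity, ?_⟩, fun b => ?_, ?_⟩
  · rw [div_lt_one (by positivity)]
    nlinarith [mul_pos h2 h2]
  · rw [gf_subst_loop prefixFamily_equalPair, hnone, gf_equalPair_some]
    cases b
    · rw [coin_false, coin_false, ← ENNReal.ofReal_mul h2.le,
        inv_one_sub_ofReal_mul (by positivity) hlt, hden]
      congr 1
      field_simp
      ring
    · rw [coin_true, coin_true, ← ENNReal.ofReal_mul h1.le,
        inv_one_sub_ofReal_mul (by positivity) hlt, hden]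
  · refine exists_gf_subst_loop_ne_top prefixFamily_equalPair length_equalPair
      (r := 2 * (p * (1 - p))) (by positivity) hlt hnone fun b => ?_
    rw [gf_equalPair_some]
    exact ENNReal.mul_ne_top (coin_ne_top _ _) (coin_ne_top _ _)

/-- Binary digits of a number of `[0, 1]`. -/
lemma exists_binary_digits {θ : ℝ} (h : θ ∈ Set.Icc (0 : ℝ) 1) :
    ∃ d : ℕ → Bool, ∑' n, (if d n then ENNReal.ofReal (1 / 2) ^ n * ENNReal.ofReal (1 / 2) else 0)
      = ENNReal.ofReal θ := by
  rcases h.2.eq_or_lt with rfl | h1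
  · refine ⟨fun _ => true, ?_⟩
    simp only [if_true, ENNReal.tsum_mul_right, ENNReal.tsum_geometric]
    rw [inv_one_sub_ofReal_mul (by norm_num) (by norm_num)]
    norm_num
  · refine ⟨fun n => Real.digits θ 2 n = 1, ?_⟩
    have hs : HasSum (Real.ofDigitsTerm (Real.digits θ 2)) θ := by
      have := (Real.summable_ofDigitsTerm (digits := Real.digits θ 2)).hasSum
      have h2 : Real.ofDigits (Real.digits θ 2) = θ :=
        Real.ofDigits_digits (by norm_num) ⟨h.1, h1⟩
      rwa [← Real.ofDigits, h2] at this
    conv_rhs => rw [← hs.tsum_eq]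
    rw [ENNReal.ofReal_tsum_of_nonneg (fun n => Real.ofDigitsTerm_nonneg) hs.summable]
    refine tsum_congr fun n => ?_
    simp only [Real.ofDigitsTerm, decide_eq_true_eq]
    generalize Real.digits θ 2 n = k
    fin_cases k
    · simp
    · rw [← ENNReal.ofReal_pow (by norm_num), ← ENNReal.ofReal_mul (by positivity)]
      simp [pow_succ, mul_comm]

/-- From fair tosses to a coin whose binary digits are `d`: output the digit whose number is the
time of the first heads. -/
def digitWords (d : ℕ → Bool) (b : Bool) : Set (List Bool) :=
  (fun n : ℕ => List.replicate n false ++ [true]) '' {n | d n = b}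

lemma prefixFamily_digitWords (d : ℕ → Bool) : PrefixFamily (digitWords d) := by
  rintro a b _ ⟨n, hn, rfl⟩ _ ⟨m, hm, rfl⟩ h
  obtain ⟨rfl, -⟩ := prefix_loop (by simp) (by simp) n m h
  exact ⟨hn.symm.trans hm, rfl⟩

lemma gf_digitWords (x : Bool → ℝ≥0∞) (d : ℕ → Bool) (b : Bool) :
    gf x (digitWords d b) = ∑' n, if d n = b then x false ^ n * x true else 0 := by
  rw [digitWords, gf_image _ _ (loop_injective (by simp)).injOn,
    tsum_subtype {n | d n = b} fun n => wordWeight x (List.replicate n false ++ [true])]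
  refine tsum_congr fun n => ?_
  simp [Set.indicator_apply]

lemma tsum_bool_add {α : Type*} (d : α → Bool) (g : α → ℝ≥0∞) :
    (∑' n, if d n = true then g n else 0) + (∑' n, if d n = false then g n else 0) = ∑' n, g n := by
  rw [← ENNReal.tsum_add]
  refine tsum_congr fun n => ?_
  cases d n <;> simp

/-- The weight of tails need not be computed separately if the total weight is `1`. -/
lemma eq_coin_of_add_eq_one {g : Bool → ℝ≥0∞} {θ : ℝ} (h : θ ∈ Set.Icc (0 : ℝ) 1)
    (hsum : g true + g false = 1) (ht : g true = ENNReal.ofReal θ) (b : Bool) :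
    g b = coin θ b := by
  cases b
  · rw [coin_false, ENNReal.ofReal_sub _ h.1, ENNReal.ofReal_one, ← ht]
    refine ENNReal.eq_sub_of_add_eq ?_ (by rwa [add_comm])
    rw [ht]
    exact ENNReal.ofReal_ne_top
  · exact ht

/-- Coins with constant probability `θ` can be simulated with exponential tails that are uniform
in `θ`, since the algorithms for different `θ` only differ in their output. -/
lemma exists_constant_coin : ∃ K : ℝ → Bool → Set (List Bool),
    (∀ θ, PrefixFamily (K θ)) ∧ ∀ p ∈ Set.Ioo (0 : ℝ) 1,
      (∀ θ ∈ Set.Icc (0 : ℝ) 1, ∀ b, gf (coin p) (K θ b) = coin θ b) ∧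
      ∃ s C : ℝ≥0∞, 1 < s ∧ C ≠ ⊤ ∧ ∀ θ b, gf (fun a => s * coin p a) (K θ b) ≤ C := by
  have hd : ∀ θ : ℝ, ∃ d : ℕ → Bool, θ ∈ Set.Icc (0 : ℝ) 1 →
      ∑' n, (if d n then ENNReal.ofReal (1 / 2) ^ n * ENNReal.ofReal (1 / 2) else 0)
      = ENNReal.ofReal θ := by
    intro θ
    by_cases h : θ ∈ Set.Icc (0 : ℝ) 1
    · obtain ⟨d, hd⟩ := exists_binary_digits h
      exact ⟨d, fun _ => hd⟩
    · exact ⟨fun _ => true, fun h' => absurd h' h⟩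
  choose d hd using hd
  refine ⟨fun θ b => subst fair (digitWords (d θ) b),
    fun θ => prefixFamily_fair.subst (prefixFamily_digitWords _), fun p hp => ⟨?_, ?_⟩⟩
  · intro θ hθ
    have hgf : ∀ b, gf (coin p) (subst fair (digitWords (d θ) b)) =
        ∑' n, if d θ n = b then ENNReal.ofReal (1 / 2) ^ n * ENNReal.ofReal (1 / 2) else 0 := by
      intro b
      rw [gf_subst _ prefixFamily_fair ((prefixFamily_digitWords _).prefixFree b), gf_digitWords,
        gf_coin_fair hp, gf_coin_fair hp]
    refine eq_coin_of_add_eq_one hθ ?_ ?_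
    · simp only [hgf]
      rw [tsum_bool_add, ENNReal.tsum_mul_right, ENNReal.tsum_geometric,
        inv_one_sub_ofReal_mul (by norm_num) (by norm_num)]
      norm_num
    · simp only [hgf, hd θ hθ]
  · obtain ⟨s₀, hs₀, hfin⟩ := exists_gf_fair_ne_top hp
    have h32 : (1 : ℝ≥0∞) < ENNReal.ofReal (3 / 2) := by
      rw [← ENNReal.ofReal_one]
      exact (ENNReal.ofReal_lt_ofReal_iff (by norm_num)).2 (by norm_num)
    have key : ∀ b, ∃ t : ℝ≥0∞, 1 < t ∧
        gf (fun a => t * coin p a) (fair b) ≤ ENNReal.ofReal (3 / 4) := by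
      intro b
      obtain ⟨t, ht, h⟩ := exists_gf_le hs₀ h32 (L := fair b) (x := coin p)
        (by rw [gf_coin_fair hp]; simp) (hfin b)
      refine ⟨t, ht, h.trans (le_of_eq ?_)⟩
      rw [gf_coin_fair hp, ← ENNReal.ofReal_mul (by norm_num)]
      norm_num
    choose t ht1 ht2 using key
    refine ⟨min (t true) (t false),
      (1 - ENNReal.ofReal (3 / 4))⁻¹ * ENNReal.ofReal (3 / 4), lt_min (ht1 _) (ht1 _), ?_, ?_⟩
    · rw [inv_one_sub_ofReal_mul (by norm_num) (by norm_num)]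
      exact ENNReal.ofReal_ne_top
    · intro θ b
      have hle : ∀ a, gf (fun a' => min (t true) (t false) * coin p a') (fair a)
          ≤ ENNReal.ofReal (3 / 4) := by
        intro a
        refine le_trans (gf_mono (fun a' => ?_) _) (ht2 a)
        gcongr
        cases a
        · exact min_le_right _ _
        · exact min_le_left _ _
      rw [gf_subst _ prefixFamily_fair ((prefixFamily_digitWords _).prefixFree b), gf_digitWords]
      calc _ ≤ ∑' n : ℕ, ENNReal.ofReal (3 / 4) ^ n * ENNReal.ofReal (3 / 4) := by
            refine ENNReal.tsum_le_tsum fun n => ?_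
            split_ifs
            · gcongr
              · exact hle _
              · exact hle _
            · exact zero_le
        _ = _ := by rw [ENNReal.tsum_mul_right, ENNReal.tsum_geometric]

/-- A stopping rule given by a language `L` together with a randomized declaration: after the word
`w`, heads is declared with probability `θ w`. -/
lemma fastOn_of_randomized {L : Set (List Bool)} (hL : PrefixFree L) {θ : List Bool → ℝ}
    (hθ : ∀ w ∈ L, θ w ∈ Set.Icc (0 : ℝ) 1) {F : ℝ → ℝ} {S : Set ℝ}
    (h : ∀ p ∈ S, p ∈ Set.Ioo (0 : ℝ) 1 ∧ F p ∈ Set.Ioo (0 : ℝ) 1 ∧ gf (coin p) L = 1 ∧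
      ∑' w : L, wordWeight (coin p) w.1 * ENNReal.ofReal (θ w.1) = ENNReal.ofReal (F p) ∧
      ∃ s : ℝ≥0∞, 1 < s ∧ gf (fun a => s * coin p a) L ≠ ⊤) :
    FastOn F S := by
  obtain ⟨K, hK, hK'⟩ := exists_constant_coin
  refine ⟨fun b => CoinFactory.bind L fun w => K (θ w) b,
    PrefixFamily.bind hL fun u _ => hK (θ u), fun p hp => ?_⟩
  obtain ⟨h1, h2, h3, h4, s, hs, h5⟩ := h p hp
  obtain ⟨h6, s', C, hs', hC, h7⟩ := hK' p h1
  have hgf : ∀ b, gf (coin p) (CoinFactory.bind L fun w => K (θ w) b)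
      = ∑' w : L, wordWeight (coin p) w.1 * coin (θ w.1) b := by
    intro b
    rw [gf_bind _ hL]
    exact tsum_congr fun w => by rw [h6 _ (hθ w.1 w.2)]
  refine ⟨h1, h2, ?_, min s s', lt_min hs hs', fun b => ?_⟩
  · refine eq_coin_of_add_eq_one ⟨h2.1.le, h2.2.le⟩ ?_ ?_
    · rw [hgf, hgf, ← ENNReal.tsum_add, ← h3, gf]
      refine tsum_congr fun w => ?_
      have hw := hθ w.1 w.2
      rw [← mul_add, coin_true, coin_false, ← ENNReal.ofReal_add hw.1 (by linarith [hw.2])]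
      simp
    · rw [hgf]
      exact h4
  · rw [gf_bind _ hL]
    refine ne_top_of_le_ne_top (ENNReal.mul_ne_top h5 hC) ?_
    rw [gf, ← ENNReal.tsum_mul_right]
    refine ENNReal.tsum_le_tsum fun w => ?_
    gcongr ?_ * ?_
    · refine wordWeight_mono (fun a => ?_) _
      gcongr
      exact min_le_left _ _
    · refine le_trans (gf_mono (fun a => ?_) _) (h7 (θ w.1) b)
      gcongr
      exact min_le_right _ _

/-! ### Power series with bounded partial sums -/

/-- The words consisting of heads followed by one tails. -/
def runs : Set (List Bool) := Set.range fun n : ℕ => List.replicate n true ++ [false]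

lemma prefixFree_runs : PrefixFree runs := by
  rintro _ ⟨n, rfl⟩ _ ⟨m, rfl⟩ h
  obtain ⟨rfl, -⟩ := prefix_loop (by simp) (by simp) n m h
  rfl

/-- The length of the first run of heads decides, after randomization: this gives every function
`∑ θ n * x ^ n * (1 - x)` with `θ n ∈ [0, 1]`. -/
lemma fastOn_of_hasSum_runs {θ : ℕ → ℝ} (hθ : ∀ n, θ n ∈ Set.Icc (0 : ℝ) 1) {F : ℝ → ℝ}
    {S : Set ℝ} (h : ∀ x ∈ S, x ∈ Set.Ioo (0 : ℝ) 1 ∧ F x ∈ Set.Ioo (0 : ℝ) 1 ∧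
      HasSum (fun n => θ n * x ^ n * (1 - x)) (F x)) : FastOn F S := by
  refine fastOn_of_randomized prefixFree_runs (θ := fun w => θ (w.length - 1))
    (fun w _ => hθ _) fun x hx => ?_
  obtain ⟨h1, h2, h3⟩ := h x hx
  have hx0 : 0 < x := h1.1
  have hx1 : 0 < 1 - x := by linarith [h1.2]
  refine ⟨h1, h2, ?_, ?_, ?_⟩
  · rw [runs, gf_range _ (loop_injective (by simp))]
    simp only [wordWeight_append, wordWeight_replicate, wordWeight_cons, wordWeight_nil, mul_one]
    rw [ENNReal.tsum_mul_right, ENNReal.tsum_geometric, coin_true, coin_false,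
      inv_one_sub_ofReal_mul hx0.le h1.2, div_self hx1.ne', ENNReal.ofReal_one]
  · rw [runs, tsum_range (fun w => wordWeight (coin x) w * ENNReal.ofReal (θ (w.length - 1)))
      (loop_injective (by simp)), ← h3.tsum_eq, ENNReal.ofReal_tsum_of_nonneg _ h3.summable]
    · refine tsum_congr fun n => ?_
      have := (hθ n).1
      simp only [wordWeight_append, wordWeight_replicate, wordWeight_cons, wordWeight_nil, mul_one,
        coin_true, coin_false, List.length_append, List.length_replicate, List.length_singleton,
        Nat.add_sub_cancel]
      rw [← ENNReal.ofReal_pow hx0.le, ← ENNReal.ofReal_mul (by positivity),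
        ← ENNReal.ofReal_mul (by positivity)]
      congr 1
      ring
    · intro n
      have := (hθ n).1
      positivity
  · obtain ⟨s, hs, hsx⟩ := exists_sq_mul_lt_one hx0.le h1.2
    refine ⟨ENNReal.ofReal s, by simpa using hs, ?_⟩
    have hsx' : s * x < 1 := by nlinarith [mul_pos (by linarith : (0 : ℝ) < s) hx0]
    rw [runs, gf_range _ (loop_injective (by simp))]
    simp only [wordWeight_append, wordWeight_replicate, wordWeight_cons, wordWeight_nil, mul_one]
    rw [ENNReal.tsum_mul_right, ENNReal.tsum_geometric, coin_true, coin_false,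
      ← ENNReal.ofReal_mul (by linarith), ← ENNReal.ofReal_mul (by linarith),
      inv_one_sub_ofReal_mul (by positivity) hsx']
    exact ENNReal.ofReal_ne_top

lemma hasSum_of_eq {f g : ℕ → ℝ} {a b : ℝ} (h : HasSum f a) (hfg : ∀ n, g n = f n)
    (hab : b = a) : HasSum g b := by
  rwa [hab, funext hfg]

/-- Summation by parts for power series. -/
lemma hasSum_partialSums {a : ℕ → ℝ} {x F : ℝ} (hx0 : 0 ≤ x) (hx1 : x < 1) {B : ℝ}
    (hB : ∀ n, |∑ j ∈ Finset.range (n + 1), a j| ≤ B) (h : HasSum (fun n => a n * x ^ n) F) :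
    HasSum (fun n => (∑ j ∈ Finset.range (n + 1), a j) * x ^ n * (1 - x)) F := by
  set P : ℕ → ℝ := fun n => ∑ j ∈ Finset.range (n + 1), a j with hP
  have hsum : Summable fun n => P n * x ^ n := by
    refine Summable.of_norm_bounded (g := fun n => B * x ^ n)
      ((summable_geometric_of_lt_one hx0 hx1).mul_left B) fun n => ?_
    rw [norm_mul, Real.norm_eq_abs, Real.norm_of_nonneg (by positivity)]
    exact mul_le_mul_of_nonneg_right (hB n) (by positivity)
  have h1 : HasSum (fun n => P n * x ^ n) (∑' n, P n * x ^ n) := hsum.hasSum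
  have h2 : HasSum (fun n => P n * x ^ n - a n * x ^ n) (∑' n, P n * x ^ n - F) := h1.sub h
  have h3 : HasSum (fun n => x * (P n * x ^ n)) (x * ∑' n, P n * x ^ n) := h1.mul_left x
  have h4 : HasSum (fun n => P n * x ^ n - a n * x ^ n) (x * ∑' n, P n * x ^ n) := by
    rw [← hasSum_nat_add_iff' 1]
    refine hasSum_of_eq h3 (fun n => ?_) ?_
    · have : P (n + 1) = P n + a (n + 1) := Finset.sum_range_succ _ _
      rw [this]
      ring
    · simp [hP]
  have h5 := h2.unique h4
  have h6 : F = (∑' n, P n * x ^ n) * (1 - x) := by linarith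
  rw [h6]
  exact h1.mul_right (1 - x)

/-- Multiplication by a constant in `(0, 1]`. -/
lemma fastOn_const_mul {κ : ℝ} (h0 : 0 < κ) (h1 : κ ≤ 1) :
    FastOn (fun x => κ * x) (Set.Ioo 0 1) := by
  refine fastOn_of_hasSum_runs (θ := fun n => if n = 0 then 0 else κ) (fun n => ?_) fun x hx => ?_
  · split_ifs
    · simp
    · exact ⟨h0.le, h1⟩
  · refine ⟨hx, ⟨mul_pos h0 hx.1, by nlinarith [hx.1, hx.2]⟩, ?_⟩
    rw [← hasSum_nat_add_iff' 1]
    have hx1 : 1 - x ≠ 0 := by linarith [hx.2]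
    have := (hasSum_geometric_of_lt_one hx.1.le hx.2).mul_left (κ * x * (1 - x))
    refine hasSum_of_eq this (fun n => ?_) ?_
    · simp only [Nat.add_eq_zero_iff, one_ne_zero, and_false, if_false]
      ring
    · simp [hx1]

lemma fastOn_id : FastOn (fun x : ℝ => x) (Set.Ioo 0 1) :=
  (fastOn_const_mul one_pos le_rfl).congr fun p _ => (one_mul p).symm

/-- Averages of the given coin with heads. -/
lemma fastOn_mix_one {r : ℝ} (h0 : 0 ≤ r) (h1 : r < 1) :
    FastOn (fun x => r + (1 - r) * x) (Set.Ioo 0 1) := by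
  have := ((fastOn_const_mul (κ := 1 - r) (by linarith) (by linarith)).comp
    (g := fun x => 1 - x) (S := Set.Ioo 0 1) (T := Set.Ioo 0 1) ?_ ?_).one_sub
  · refine this.congr fun p _ => ?_
    ring
  · exact fastOn_id.one_sub
  · intro p hp
    exact ⟨by linarith [hp.2], by linarith [hp.1]⟩

/-- Multiplication of the odds by a constant `c ≥ 1`. -/
lemma fastOn_mul_odds {c : ℝ} (hc : 1 ≤ c) :
    FastOn (fun t => c * t / (c * t + (1 - t))) (Set.Ioo 0 1) := by
  have hmain : FastOn (fun x => c * (1 - x) / (c * (1 - x) + x)) (Set.Ioo 0 1) := by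
    have hr0 : 0 ≤ 1 - 1 / c := by
      have : 1 / c ≤ 1 := by rw [div_le_one (by linarith)]; exact hc
      linarith
    have hr1 : 1 - 1 / c < 1 := by
      have : 0 < 1 / c := by positivity
      linarith
    refine fastOn_of_hasSum_runs (θ := fun n => (1 - 1 / c) ^ n)
      (fun n => ⟨pow_nonneg hr0 n, pow_le_one₀ hr0 hr1.le⟩) fun x hx => ?_
    have hx0 := hx.1
    have hx1 : 0 < 1 - x := by linarith [hx.2]
    refine ⟨hx, ⟨by positivity, ?_⟩, ?_⟩
    · rw [div_lt_one (by positivity)]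
      linarith
    · have hlt : (1 - 1 / c) * x < 1 := by nlinarith
      have := (hasSum_geometric_of_lt_one (by positivity) hlt).mul_right (1 - x)
      refine hasSum_of_eq this (fun n => ?_) ?_
      · rw [mul_pow]
      · have h1 : 1 - (1 - 1 / c) * x = (c * (1 - x) + x) / c := by
          field_simp
          ring
        rw [h1]
        field_simp
  refine (hmain.comp fastOn_id.one_sub fun p hp => ⟨?_, ?_⟩).congr fun p _ => ?_
  · linarith [hp.2]
  · linarith [hp.1]
  · congr 2 <;> ring

/-- Constants in `(0, 1)`. -/
lemma fastOn_const {θ : ℝ} (hθ : θ ∈ Set.Ioo (0 : ℝ) 1) : FastOn (fun _ => θ) (Set.Ioo 0 1) := by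
  refine fastOn_of_hasSum_runs (θ := fun _ => θ) (fun _ => ⟨hθ.1.le, hθ.2.le⟩) fun x hx =>
    ⟨hx, hθ, ?_⟩
  have hx1 : 1 - x ≠ 0 := by linarith [hx.2]
  have := (hasSum_geometric_of_lt_one hx.1.le hx.2).mul_left (θ * (1 - x))
  refine hasSum_of_eq this (fun n => ?_) ?_
  · ring
  · field_simp

/-! ### First passage of a skip-free walk -/

/-- `hit e m w` says that the walk which starts at height `m`, steps down by `1` at tails and up by
`e` at heads reaches height `0` for the first time at the end of the word `w`. -/
def hit (e : ℕ) : ℕ → List Bool → Prop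
  | 0, w => w = []
  | _ + 1, [] => False
  | m + 1, false :: w => hit e m w
  | m + 1, true :: w => hit e (m + 1 + e) w

/-- The words after which the walk from height `m` has just reached `0`. -/
def hitWords (e m : ℕ) : Set (List Bool) := {w | hit e m w}

lemma prefixFree_hitWords (e : ℕ) : ∀ m, PrefixFree (hitWords e m) := by
  intro m u hu v hv h
  induction u generalizing m v with
  | nil =>
    cases m with
    | zero => simp_all [hitWords, hit]
    | succ m => simp [hitWords, hit] at hu
  | cons b u ih =>
    cases m with
    | zero => simp [hitWords, hit] at hu
    | succ m =>
      cases v with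
      | nil => simp at h
      | cons b' v =>
        rw [List.cons_prefix_cons] at h
        obtain ⟨rfl, h⟩ := h
        cases b
        · rw [ih m hu _ hv h]
        · rw [ih (m + 1 + e) hu _ hv h]

lemma disjoint_cons (L M : Set (List Bool)) :
    Disjoint (List.cons true '' L) (List.cons false '' M) := by
  rw [Set.disjoint_left]
  rintro _ ⟨u, -, rfl⟩ ⟨v, -, h⟩
  simp at h

/-- The first-step decomposition, restricted to words with a property `Q`. -/
lemma gf_hit_succ (x : Bool → ℝ≥0∞) (e m : ℕ) (Q : List Bool → Prop) :
    gf x {w | hit e (m + 1) w ∧ Q w} =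
      x true * gf x {w | hit e (m + 1 + e) w ∧ Q (true :: w)} +
      x false * gf x {w | hit e m w ∧ Q (false :: w)} := by
  rw [← gf_cons, ← gf_cons, ← gf_union x (disjoint_cons _ _)]
  congr 1
  ext w
  rcases w with _ | ⟨_ | _, w⟩ <;> simp [hit]

/-- A superharmonic function of the height bounds the generating function. -/
lemma gf_hitWords_le {x : Bool → ℝ≥0∞} {e : ℕ} {φ : ℕ → ℝ≥0∞} (h0 : 1 ≤ φ 0)
    (hφ : ∀ m, x true * φ (m + 1 + e) + x false * φ m ≤ φ (m + 1)) (m : ℕ) :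
    gf x (hitWords e m) ≤ φ m := by
  refine gf_le_of_length_le fun n => ?_
  induction n generalizing m with
  | zero =>
    cases m with
    | zero =>
      have : {w | w ∈ hitWords e 0 ∧ w.length ≤ 0} = {[]} := by ext w; simp [hitWords, hit]
      rw [this]
      simpa using h0
    | succ m =>
      have : {w | w ∈ hitWords e (m + 1) ∧ w.length ≤ 0} = ∅ := by
        ext w
        cases w <;> simp [hitWords, hit]
      rw [this]
      simp
  | succ n ih =>
    cases m with
    | zero =>
      have : {w | w ∈ hitWords e 0 ∧ w.length ≤ n + 1} = {[]} := by
        ext w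
        simp only [hitWords, hit, Set.mem_ofPred_eq, Set.mem_singleton_iff, and_iff_left_iff_imp]
        rintro rfl
        simp
      rw [this]
      simpa using h0
    | succ m =>
      refine le_trans ?_ (hφ m)
      have := gf_hit_succ x e m fun w => w.length ≤ n + 1
      simp only [List.length_cons, Nat.add_le_add_iff_right] at this
      refine this.le.trans ?_
      gcongr
      · exact ih _
      · exact ih _

lemma gf_hitWords_zero (x : Bool → ℝ≥0∞) (e : ℕ) : gf x (hitWords e 0) = 1 := by
  have : hitWords e 0 = {[]} := by ext w; simp [hitWords, hit]
  simp [this]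

lemma gf_hitWords_succ (x : Bool → ℝ≥0∞) (e m : ℕ) :
    gf x (hitWords e (m + 1)) =
      x true * gf x (hitWords e (m + 1 + e)) + x false * gf x (hitWords e m) := by
  have := gf_hit_succ x e m fun _ => True
  simp only [and_true] at this
  exact this

/-- Bases `L > 1` of exponential functions of the height that are superharmonic with room to
spare, for walks with negative drift. -/
lemma exists_superharmonic {e : ℕ} {p : ℝ} (hp0 : 0 < p) (hp : p * (e + 1) < 1) :
    ∃ s L : ℝ, 1 < s ∧ 1 < L ∧ s * (p * L ^ (e + 1) + (1 - p)) ≤ L := by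
  have hcont : ContinuousAt (fun L : ℝ => p * ∑ i ∈ Finset.range (e + 1), L ^ i) 1 := by
    fun_prop
  have hlim : ∀ᶠ L in nhds (1 : ℝ), p * ∑ i ∈ Finset.range (e + 1), L ^ i < 1 := by
    refine hcont.eventually_lt continuousAt_const ?_
    simpa using hp
  obtain ⟨L, hL, hL1⟩ := ((hlim.filter_mono nhdsWithin_le_nhds).and
    (self_mem_nhdsWithin : Set.Ioi (1 : ℝ) ∈ nhdsWithin 1 (Set.Ioi 1))).exists
  have hL1' : 1 < L := hL1
  have hp1 : p < 1 := by
    have : (0 : ℝ) ≤ e := Nat.cast_nonneg e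
    nlinarith
  have hgeom := geom_sum_mul L (e + 1)
  have hlt : p * L ^ (e + 1) + (1 - p) < L := by nlinarith
  have hpos : 0 < p * L ^ (e + 1) + (1 - p) := by
    have : 0 < L ^ (e + 1) := by positivity
    nlinarith [mul_pos hp0 this]
  exact ⟨L / (p * L ^ (e + 1) + (1 - p)), L, by rwa [one_lt_div hpos], hL1',
    by rw [div_mul_cancel₀ _ hpos.ne']⟩

lemma exists_gf_hitWords_ne_top {e : ℕ} {p : ℝ} (hp0 : 0 < p) (hp : p * (e + 1) < 1) :
    ∃ s : ℝ≥0∞, 1 < s ∧ ∀ m, gf (fun a => s * coin p a) (hitWords e m) ≠ ⊤ := by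
  obtain ⟨s, L, hs, hL, h⟩ := exists_superharmonic hp0 hp
  have hp1 : p < 1 := by
    have : (0 : ℝ) ≤ e := Nat.cast_nonneg e
    nlinarith
  have hL0 : 0 < L := by linarith
  have hp1' : 0 ≤ 1 - p := by linarith
  have hs0 : 0 < s := by linarith
  refine ⟨ENNReal.ofReal s, by simpa using hs, fun m => ?_⟩
  refine ne_top_of_le_ne_top ENNReal.ofReal_ne_top
    (gf_hitWords_le (φ := fun m => ENNReal.ofReal (L ^ m)) (by simp) (fun m => ?_) m)
  rw [coin_true, coin_false, ← ENNReal.ofReal_mul hs0.le, ← ENNReal.ofReal_mul hs0.le,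
    ← ENNReal.ofReal_mul (by positivity), ← ENNReal.ofReal_mul (by positivity),
    ← ENNReal.ofReal_add (by positivity) (by positivity)]
  refine ENNReal.ofReal_le_ofReal ?_
  calc s * p * L ^ (m + 1 + e) + s * (1 - p) * L ^ m
      = s * (p * L ^ (e + 1) + (1 - p)) * L ^ m := by ring
    _ ≤ L * L ^ m := by gcongr
    _ = L ^ (m + 1) := by ring

/-- A walk with negative drift reaches `0`. -/
lemma gf_hitWords_eq_one {e : ℕ} {p : ℝ} (hp0 : 0 < p) (hp : p * (e + 1) < 1) (m : ℕ) :
    gf (coin p) (hitWords e m) = 1 := by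
  obtain ⟨s, L, hs, hL, h⟩ := exists_superharmonic hp0 hp
  have hp1 : p < 1 := by
    have : (0 : ℝ) ≤ e := Nat.cast_nonneg e
    nlinarith
  have hL0 : 0 < L := by linarith
  have hp1' : 0 ≤ 1 - p := by linarith
  have hle : ∀ m, gf (coin p) (hitWords e m) ≤ 1 := by
    refine gf_hitWords_le (φ := fun _ => 1) le_rfl fun m => ?_
    rw [coin_true, coin_false, mul_one, mul_one, ← ENNReal.ofReal_add hp0.le hp1']
    simp
  set T : ℕ → ℝ := fun m => (gf (coin p) (hitWords e m)).toReal with hT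
  have hT' : ∀ m, gf (coin p) (hitWords e m) = ENNReal.ofReal (T m) := fun m =>
    (ENNReal.ofReal_toReal (ne_top_of_le_ne_top (by simp) (hle m))).symm
  have hTnn : ∀ m, 0 ≤ T m := fun m => ENNReal.toReal_nonneg
  have hT0 : T 0 = 1 := by simp [hT, gf_hitWords_zero]
  have hTs : ∀ m, T (m + 1) = p * T (m + 1 + e) + (1 - p) * T m := by
    intro m
    have := gf_hitWords_succ (coin p) e m
    rw [hT', hT', hT', coin_true, coin_false, ← ENNReal.ofReal_mul hp0.le,
      ← ENNReal.ofReal_mul hp1', ← ENNReal.ofReal_add (mul_nonneg hp0.le (hTnn _))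
        (mul_nonneg hp1' (hTnn _)), ENNReal.ofReal_eq_ofReal_iff (hTnn _)
        (add_nonneg (mul_nonneg hp0.le (hTnn _)) (mul_nonneg hp1' (hTnn _)))] at this
    exact this
  have hlow : ∀ n m : ℕ, 1 ≤ T m + L ^ m * (1 / s) ^ n := by
    intro n
    induction n with
    | zero =>
      intro m
      have : 1 ≤ L ^ m := one_le_pow₀ hL.le
      simpa using this.trans (le_add_of_nonneg_left (hTnn m))
    | succ n ih =>
      intro m
      cases m with
      | zero =>
        rw [hT0]
        have : (0 : ℝ) ≤ L ^ 0 * (1 / s) ^ (n + 1) := by positivity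
        linarith
      | succ m =>
        have h1 := mul_le_mul_of_nonneg_left (ih (m + 1 + e)) hp0.le
        have h2 := mul_le_mul_of_nonneg_left (ih m) hp1'
        have h3 : (p * L ^ (m + 1 + e) + (1 - p) * L ^ m) * (1 / s) ^ n
            ≤ L ^ (m + 1) * (1 / s) ^ (n + 1) := by
          have h4 : p * L ^ (e + 1) + (1 - p) ≤ L * (1 / s) := by
            rw [mul_one_div, le_div_iff₀ (by linarith)]
            linarith
          calc (p * L ^ (m + 1 + e) + (1 - p) * L ^ m) * (1 / s) ^ n
              = (p * L ^ (e + 1) + (1 - p)) * (L ^ m * (1 / s) ^ n) := by ring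
            _ ≤ L * (1 / s) * (L ^ m * (1 / s) ^ n) := by gcongr
            _ = L ^ (m + 1) * (1 / s) ^ (n + 1) := by ring
        rw [hTs m]
        linarith
  have h1s : 1 / s < 1 := by rw [div_lt_one (by linarith)]; exact hs
  have hlim : Filter.Tendsto (fun n : ℕ => T m + L ^ m * (1 / s) ^ n) Filter.atTop
      (nhds (T m + L ^ m * 0)) :=
    ((tendsto_pow_atTop_nhds_zero_of_lt_one (by positivity) h1s).const_mul _).const_add _
  have hge : 1 ≤ T m := by
    have := ge_of_tendsto' hlim fun n => hlow n m
    simpa using this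
  refine le_antisymm (hle m) ?_
  rw [hT', ← ENNReal.ofReal_one]
  exact ENNReal.ofReal_le_ofReal hge

/-- The number of words with `k` heads after which the walk from height `m` has just
reached `0`. -/
def hitCount (e : ℕ) : ℕ → ℕ → ℕ
  | 0, 0 => 1
  | 0, _ + 1 => 0
  | m + 1, 0 => hitCount e m 0
  | m + 1, k + 1 => hitCount e m (k + 1) + hitCount e (m + 1 + e) k
termination_by m k => (k, m)

lemma gf_hit_count (x : Bool → ℝ≥0∞) (e m k : ℕ) :
    gf x {w | hit e m w ∧ w.count true = k} =
      hitCount e m k * x true ^ k * x false ^ (e * k + m) := by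
  induction m, k using hitCount.induct e with
  | case1 =>
    have : {w | hit e 0 w ∧ w.count true = 0} = {[]} := by
      ext w
      simp only [hit, Set.mem_ofPred_eq, Set.mem_singleton_iff, and_iff_left_iff_imp]
      rintro rfl
      simp
    simp [this, hitCount]
  | case2 k =>
    have : {w | hit e 0 w ∧ w.count true = k + 1} = ∅ := by
      ext w
      simp only [hit, Set.mem_ofPred_eq, Set.mem_empty_iff_false, iff_false, not_and]
      rintro rfl
      simp
    simp [this, hitCount]
  | case3 m ih =>
    rw [gf_hit_succ]
    have h1 : {w | hit e (m + 1 + e) w ∧ (true :: w).count true = 0} = ∅ := by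
      ext w
      simp
    have h2 : {w | hit e m w ∧ (false :: w).count true = 0}
        = {w | hit e m w ∧ w.count true = 0} := by
      ext w
      simp
    rw [h1, h2, ih, hitCount, gf_empty, Nat.succ_eq_add_one]
    ring
  | case4 m k ih1 ih2 =>
    rw [gf_hit_succ]
    have h1 : {w | hit e (m + 1 + e) w ∧ (true :: w).count true = k + 1}
        = {w | hit e (m + 1 + e) w ∧ w.count true = k} := by
      ext w
      simp
    have h2 : {w | hit e m w ∧ (false :: w).count true = k + 1}
        = {w | hit e m w ∧ w.count true = k + 1} := by
      ext w
      simp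
    rw [h1, h2, ih1, ih2, hitCount]
    simp only [Nat.succ_eq_add_one]
    push_cast
    ring

lemma hitCount_zero_right (e m : ℕ) : hitCount e m 0 = 1 := by
  induction m with
  | zero => simp [hitCount]
  | succ m ih => rw [hitCount, ih]

/-- The cycle lemma: among all words with `k` heads and of the length at which the walk from
height `m` is at `0`, a fraction `m / n` visits `0` for the first time at the end, where `n` is the
length. -/
lemma hitCount_mul (e m k : ℕ) :
    ((e + 1) * k + m) * hitCount e m k = m * ((e + 1) * k + m).choose k := by
  induction m, k using hitCount.induct e with
  | case1 => simp
  | case2 k => simp [hitCount]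
  | case3 m _ => simp [hitCount_zero_right]
  | case4 m k ih1 ih2 =>
    rw [hitCount]
    set N := (e + 1) * (k + 1) + m with hN
    have hN1 : (e + 1) * (k + 1) + (m + 1) = N + 1 := by omega
    have hN2 : (e + 1) * k + (m + 1 + e) = N := by rw [hN]; ring
    have hkN : k ≤ N := by nlinarith
    have hN0 : 0 < N := by positivity
    rw [hN2] at ih2
    rw [hN1, Nat.choose_succ_succ]
    have hch := Nat.choose_succ_right_eq N k
    zify [hkN] at ih1 ih2 hch ⊢
    have hNz : (N : ℤ) = (e + 1) * (k + 1) + m := by rw [hN]; push_cast; ring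
    refine mul_left_cancel₀ (show (N : ℤ) ≠ 0 by exact_mod_cast hN0.ne') ?_
    linear_combination (N + 1 : ℤ) * ih1 + (N + 1 : ℤ) * ih2 - (e + 1 : ℤ) * hch
      - ((N.choose (k + 1) : ℤ) + N.choose k) * hNz

/-- The proportion, among the words with `k + 1` heads, of those beginning with heads. -/
lemma hitCount_first_heads (e m k : ℕ) :
    (m + 1) * ((e + 1) * (k + 1) + m) * hitCount e (m + 1 + e) k =
      (m + 1 + e) * (k + 1) * hitCount e (m + 1) (k + 1) := by
  have h1 := hitCount_mul e (m + 1) (k + 1)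
  have h2 := hitCount_mul e (m + 1 + e) k
  set N := (e + 1) * (k + 1) + m with hN
  have hN1 : (e + 1) * (k + 1) + (m + 1) = N + 1 := by omega
  have hN2 : (e + 1) * k + (m + 1 + e) = N := by rw [hN]; ring
  rw [hN1] at h1
  rw [hN2] at h2
  have h3 := Nat.add_one_mul_choose_eq N k
  zify at h1 h2 h3 ⊢
  refine mul_left_cancel₀ (show (N + 1 : ℤ) ≠ 0 by positivity) ?_
  linear_combination (N + 1 : ℤ) * (m + 1) * h2 - (m + 1 + e : ℤ) * (k + 1) * h1
    + (m + 1 + e : ℤ) * (m + 1) * h3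

/-- Grouping the words of a language by the value of a statistic `ν`. -/
lemma tsum_by_statistic (ν : List Bool → ℕ) (x : Bool → ℝ≥0∞) (L : Set (List Bool))
    (h : ℕ → ℝ≥0∞) :
    ∑' w : L, wordWeight x w.1 * h (ν w.1) = ∑' k, gf x {w | w ∈ L ∧ ν w = k} * h k := by
  classical
  have h1 : ∀ k, gf x {w | w ∈ L ∧ ν w = k} * h k
      = ∑' w : L, if ν w.1 = k then wordWeight x w.1 * h k else 0 := by
    intro k
    rw [gf, tsum_subtype {w | w ∈ L ∧ ν w = k} (wordWeight x), ← ENNReal.tsum_mul_right,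
      tsum_subtype L fun w => if ν w = k then wordWeight x w * h k else 0]
    refine tsum_congr fun w => ?_
    by_cases hw : w ∈ L <;> by_cases hk : ν w = k <;> simp [hw, hk]
  simp only [h1]
  rw [ENNReal.tsum_comm]
  refine tsum_congr fun w => ?_
  rw [tsum_eq_single (ν w.1)]
  · simp
  · intro k hk
    simp [hk.symm]

/-- Multiplication by a constant `C > 1` on an interval where the product is bounded away from `1`.
Let a walk with negative drift run until it reaches `0`. Given the number of heads until then, the
conditional probability that the first toss shows heads does not depend on the coin, and for a large
initial height it is at most `1 / C`, so heads can be declared with `C` times that probability. -/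
lemma fastOn_linear {e : ℕ} {C : ℝ} (hC : 0 < C) (hCe : C < e + 1) :
    FastOn (fun x => C * x) (Set.Ioo 0 (1 / (e + 1))) := by
  obtain ⟨m, hm⟩ := exists_nat_gt (C * e / (e + 1 - C))
  have hm' : C * (m + 1 + e) ≤ (m + 1) * (e + 1) := by
    rw [div_lt_iff₀ (by linarith)] at hm
    nlinarith
  set θ : ℕ → ℝ := fun k => C * (m + 1 + e) * k / ((m + 1) * ((e + 1) * k + m)) with hθ
  have hθ0 : ∀ k, 0 ≤ θ k := fun k => by positivity
  have hθ1 : ∀ k, θ k ≤ 1 := by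
    intro k
    refine div_le_one_of_le₀ ?_ (by positivity)
    have : (0 : ℝ) ≤ m * (m + 1) := by positivity
    nlinarith [mul_le_mul_of_nonneg_right hm' (Nat.cast_nonneg (α := ℝ) k)]
  refine fastOn_of_randomized (prefixFree_hitWords e (m + 1)) (θ := fun w => θ (w.count true))
    (fun w _ => ⟨hθ0 _, hθ1 _⟩) fun p hp => ?_
  have hp0 := hp.1
  have he : (0 : ℝ) ≤ e := Nat.cast_nonneg e
  have hpe : p * (e + 1) < 1 := by
    have := hp.2
    rwa [lt_div_iff₀ (by linarith)] at this
  refine ⟨⟨hp0, by nlinarith⟩, ⟨by positivity, ?_⟩, gf_hitWords_eq_one hp0 hpe _, ?_, ?_⟩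
  · nlinarith
  · rw [tsum_by_statistic (List.count true) (coin p) (hitWords e (m + 1)) fun k => ENNReal.ofReal (θ k),
      tsum_eq_zero_add' ENNReal.summable]
    have hterm : ∀ k, gf (coin p) {w | w ∈ hitWords e (m + 1) ∧ w.count true = k + 1} *
        ENNReal.ofReal (θ (k + 1)) =
        ENNReal.ofReal (C * p) * gf (coin p) {w | w ∈ hitWords e (m + 1 + e) ∧
          w.count true = k} := by
      intro k
      have h1 := gf_hit_count (coin p) e (m + 1) (k + 1)
      have h2 := gf_hit_count (coin p) e (m + 1 + e) k
      simp only [hitWords, Set.mem_ofPred_eq]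
      rw [h1, h2]
      have hexp : e * (k + 1) + (m + 1) = e * k + (m + 1 + e) := by ring
      have hcount : (hitCount e (m + 1) (k + 1) : ℝ≥0∞) * ENNReal.ofReal (θ (k + 1))
          = ENNReal.ofReal C * hitCount e (m + 1 + e) k := by
        rw [← ENNReal.ofReal_natCast, ← ENNReal.ofReal_natCast, ← ENNReal.ofReal_mul (by positivity),
          ← ENNReal.ofReal_mul (by positivity)]
        congr 1
        have := hitCount_first_heads e m k
        have h3 : ((m : ℝ) + 1) * ((e + 1) * (k + 1) + m) * hitCount e (m + 1 + e) k =
          (m + 1 + e) * (k + 1) * hitCount e (m + 1) (k + 1) := by exact_mod_cast this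
        simp only [hθ]
        push_cast
        rw [← mul_div_assoc, div_eq_iff (by positivity)]
        linear_combination -C * h3
      rw [hexp, pow_succ, ENNReal.ofReal_mul hC.le, coin_true]
      calc _ = (hitCount e (m + 1) (k + 1) : ℝ≥0∞) * ENNReal.ofReal (θ (k + 1)) *
            (ENNReal.ofReal p ^ k * ENNReal.ofReal p * coin p false ^ (e * k + (m + 1 + e))) := by
            ring
        _ = _ := by
            rw [hcount]
            ring
    simp only [hterm]
    rw [ENNReal.tsum_mul_left]
    have := tsum_by_statistic (List.count true) (coin p) (hitWords e (m + 1 + e)) fun _ => 1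
    simp only [mul_one] at this
    rw [← this]
    have h1 := gf_hitWords_eq_one hp0 hpe (m + 1 + e)
    rw [gf] at h1
    rw [h1]
    simp [hθ]
  · obtain ⟨s, hs, h⟩ := exists_gf_hitWords_ne_top hp0 hpe
    exact ⟨s, hs, h _⟩

/-- A coin can be amplified by any factor as long as the result stays away from `1`. -/
lemma FastOn.amplify {h g : ℝ → ℝ} {S : Set ℝ} (hh : FastOn h S) {A ε : ℝ} (hA : 0 < A)
    (hε : 0 < ε) (hg : ∀ p ∈ S, g p = A * h p) (hg1 : ∀ p ∈ S, g p ≤ 1 - ε) : FastOn g S := by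
  -- first reduce `h = g / A` to `g / e`, then multiply by `e` on `(0, 1 / (e + 1))`
  obtain ⟨e, he⟩ := exists_nat_gt (max A (1 / ε))
  have heA : A < e := lt_of_le_of_lt (le_max_left _ _) he
  have heε : 1 / ε < e := lt_of_le_of_lt (le_max_right _ _) he
  have he0 : (0 : ℝ) < e := hA.trans heA
  rw [div_lt_iff₀ hε] at heε
  have h1 : FastOn (fun p => A / e * h p) S :=
    (fastOn_const_mul (κ := A / e) (by positivity) (by rw [div_le_one he0]; exact heA.le)).comp hh
      fun p hp => hh.mem_Ioo hp
  refine ((fastOn_linear (e := e) (C := e) he0 (by linarith)).comp h1 fun p hp => ?_).congr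
    fun p hp => ?_
  · have h2 := hg1 p hp
    rw [hg p hp] at h2
    refine ⟨(h1.mem_Ioo hp).1, ?_⟩
    rw [div_mul_eq_mul_div, div_lt_div_iff₀ he0 (by linarith)]
    nlinarith
  · rw [hg p hp]
    field_simp

lemma FastOn.affine_of_pos {h g : ℝ → ℝ} {S : Set ℝ} (hh : FastOn h S) {A B ε : ℝ} (hA : 0 < A)
    (hε : 0 < ε) (hg : ∀ p ∈ S, g p = A * h p + B) (hg0 : ∀ p ∈ S, ε ≤ g p)
    (hg1 : ∀ p ∈ S, g p ≤ 1 - ε) : FastOn g S := by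
  -- with `D ≥ 0` and `B + D ≥ 0`, pass from `h` to `(g + D) / (1 + D)`, then to `1 - g`
  set D := |B| with hD
  have hD0 : 0 ≤ D := abs_nonneg B
  have hBD : 0 ≤ B + D := by linarith [neg_abs_le B]
  set r := (B + D) / (A + (B + D)) with hr
  have hr0 : 0 ≤ r := by positivity
  have hr1 : r < 1 := by rw [hr, div_lt_one (by positivity)]; linarith
  have h1 : FastOn (fun p => r + (1 - r) * h p) S :=
    (fastOn_mix_one hr0 hr1).comp hh fun p hp => hh.mem_Ioo hp
  have h2 : FastOn (fun p => (g p + D) / (1 + D)) S := by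
    refine h1.amplify (A := (A + (B + D)) / (1 + D)) (ε := ε / (1 + D)) (by positivity)
      (by positivity) (fun p hp => ?_) fun p hp => ?_
    · rw [hg p hp, hr]
      field_simp
      ring
    · rw [le_sub_iff_add_le, ← add_div, div_le_one (by positivity)]
      linarith [hg1 p hp]
  have h3 : FastOn (fun p => 1 - g p) S := by
    refine h2.one_sub.amplify (A := 1 + D) (ε := ε) (by positivity) hε (fun p hp => ?_)
      fun p hp => ?_
    · field_simp
      ring
    · linarith [hg0 p hp]
  exact h3.one_sub.congr fun p _ => by ring

/-- Nonconstant affine images of simulated functions can be simulated if their values stay away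
from `0` and `1`. -/
lemma FastOn.affine {h g : ℝ → ℝ} {S : Set ℝ} (hh : FastOn h S) {A B ε : ℝ} (hA : A ≠ 0)
    (hε : 0 < ε) (hg : ∀ p ∈ S, g p = A * h p + B) (hg0 : ∀ p ∈ S, ε ≤ g p)
    (hg1 : ∀ p ∈ S, g p ≤ 1 - ε) : FastOn g S := by
  rcases hA.lt_or_gt with hA | hA
  · exact hh.one_sub.affine_of_pos (A := -A) (B := A + B) (by linarith) hε
      (fun p hp => by rw [hg p hp]; ring) hg0 hg1
  · exact hh.affine_of_pos hA hε hg hg0 hg1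

/-! ### Words and events -/

/-- The first `n` tosses of a sequence. -/
def firstTosses (x : ℕ → Bool) (n : ℕ) : List Bool := (List.range n).map x

@[simp] lemma length_firstTosses (x : ℕ → Bool) (n : ℕ) : (firstTosses x n).length = n := by
  simp [firstTosses]

lemma firstTosses_congr {x y : ℕ → Bool} {n : ℕ} (h : ∀ i < n, x i = y i) :
    firstTosses x n = firstTosses y n :=
  List.map_congr_left fun i hi => h i (List.mem_range.1 hi)

lemma firstTosses_prefix (x : ℕ → Bool) {n m : ℕ} (h : n ≤ m) :
    firstTosses x n <+: firstTosses x m := by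
  obtain ⟨k, rfl⟩ := Nat.exists_eq_add_of_le h
  rw [firstTosses, firstTosses, List.range_add, List.map_append]
  exact List.prefix_append _ _

lemma PrefixFamily.eq_of_firstTosses {ι : Type*} {c : ι → Set (List Bool)} (hc : PrefixFamily c)
    {x : ℕ → Bool} {n m : ℕ} {a b : ι} (hn : firstTosses x n ∈ c a) (hm : firstTosses x m ∈ c b) :
    a = b ∧ n = m := by
  rcases le_total n m with h | h
  · have := hc a b _ hn _ hm (firstTosses_prefix x h)
    exact ⟨this.1, by simpa using congrArg List.length this.2⟩
  · have := hc b a _ hm _ hn (firstTosses_prefix x h)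
    exact ⟨this.1.symm, by simpa using (congrArg List.length this.2).symm⟩

/-- The event that the sequence of tosses begins with the word `w`. -/
def cylinder (w : List Bool) : Set (ℕ → Bool) := {x | firstTosses x w.length = w}

lemma cylinder_eq_pi (w : List Bool) :
    cylinder w = Set.pi (Finset.range w.length) fun i => {w.getD i false} := by
  ext x
  simp only [cylinder, Set.mem_ofPred_eq, Set.mem_pi, Finset.coe_range, Set.mem_Iio,
    Set.mem_singleton_iff]
  constructor
  · intro h i hi
    have h1 : (firstTosses x w.length).getD i false = x i := by
      simp [firstTosses, hi]
    rw [h] at h1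
    exact h1.symm
  · intro h
    refine List.ext_getElem (by simp) fun i h1 h2 => ?_
    have := h i h2
    simp only [firstTosses, List.getElem_map, List.getElem_range]
    rw [this]
    simp [h2]

lemma measurableSet_cylinder (w : List Bool) : MeasurableSet (cylinder w) := by
  rw [cylinder_eq_pi]
  exact MeasurableSet.pi (Finset.countable_toSet _) fun i _ => measurableSet_singleton _

lemma bernoulliMeasure_singleton (p : unitInterval) (b : Bool) :
    ProbabilityTheory.bernoulliMeasure true false p {b} = coin p b := by
  classical
  rw [ProbabilityTheory.bernoulliMeasure_apply p (measurableSet_singleton b)]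
  cases b
  · simp only [Set.mem_singleton_iff, coin_false]
    simp only [Bool.true_eq_false, if_false, if_true]
    rw [← unitInterval.coe_symm_eq, ENNReal.ofReal, Real.toNNReal_of_nonneg (unitInterval.nonneg _)]
    rfl
  · simp only [Set.mem_singleton_iff, coin_true]
    simp only [Bool.false_eq_true, if_false, if_true]
    rw [ENNReal.ofReal, Real.toNNReal_of_nonneg (unitInterval.nonneg _)]
    rfl

instance (p : unitInterval) : IsProbabilityMeasure (coinLaw p) := by
  unfold coinLaw
  infer_instance

lemma prod_range_getD (x : Bool → ℝ≥0∞) (w : List Bool) :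
    ∏ i ∈ Finset.range w.length, x (w.getD i false) = wordWeight x w := by
  induction w with
  | nil => simp
  | cons b w ih =>
    rw [List.length_cons, Finset.prod_range_succ', wordWeight_cons, ← ih, mul_comm]
    simp

lemma coinLaw_cylinder (p : unitInterval) (w : List Bool) :
    coinLaw p (cylinder w) = wordWeight (coin p) w := by
  rw [cylinder_eq_pi, coinLaw,
    Measure.infinitePi_pi _ fun i _ => measurableSet_singleton _]
  simp only [bernoulliMeasure_singleton]
  exact prod_range_getD (coin p) w

lemma setOf_exists_firstTosses (L : Set (List Bool)) :
    {x | ∃ n, firstTosses x n ∈ L} = ⋃ w : L, cylinder w.1 := by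
  ext x
  simp only [Set.mem_ofPred_eq, Set.mem_iUnion, Subtype.exists, cylinder, exists_prop]
  constructor
  · rintro ⟨n, hn⟩
    exact ⟨_, hn, by simp⟩
  · rintro ⟨w, hw, h⟩
    exact ⟨w.length, by rwa [h]⟩

lemma measurableSet_exists_firstTosses (L : Set (List Bool)) :
    MeasurableSet {x | ∃ n, firstTosses x n ∈ L} := by
  rw [setOf_exists_firstTosses]
  exact MeasurableSet.iUnion fun w => measurableSet_cylinder w.1

/-- The generating function of a prefix-free language is the probability that one of its words is
seen. -/
lemma coinLaw_exists_firstTosses (p : unitInterval) {L : Set (List Bool)} (hL : PrefixFree L) :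
    coinLaw p {x | ∃ n, firstTosses x n ∈ L} = gf (coin p) L := by
  have hdisj : Pairwise fun u v : L => Disjoint (cylinder u.1) (cylinder v.1) := by
    rintro ⟨u, hu⟩ ⟨v, hv⟩ huv
    refine Set.disjoint_left.2 fun x hx hx' => huv ?_
    have hx1 : firstTosses x u.length = u := hx
    have hx2 : firstTosses x v.length = v := hx'
    have hu' : firstTosses x u.length ∈ L := by rwa [hx1]
    have hv' : firstTosses x v.length ∈ L := by rwa [hx2]
    have hc : PrefixFamily fun _ : Unit => L := fun _ _ u hu v hv h => ⟨rfl, hL u hu v hv h⟩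
    have := (hc.eq_of_firstTosses (a := ()) (b := ()) hu' hv').2
    refine Subtype.ext ?_
    change u = v
    rw [← hx1, ← hx2, this]
  rw [setOf_exists_firstTosses, measure_iUnion hdisj fun w => measurableSet_cylinder w.1]
  simp only [coinLaw_cylinder]
  rfl

lemma gf_iUnion_bool (x : Bool → ℝ≥0∞) {c : Bool → Set (List Bool)} (hc : PrefixFamily c) :
    gf x (⋃ b, c b) = gf x (c true) + gf x (c false) := by
  rw [← gf_union x (hc.disjoint (by simp))]
  congr 1
  ext w
  simp [or_comm]

/-! ### From prefix families to algorithms -/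

open Classical in
/-- The algorithm that stops at the first word of one of the two languages `c true` and `c false`,
and declares heads if it is a word of `c true`. -/
noncomputable def algorithmOf (c : Bool → Set (List Bool)) (hc : PrefixFamily c) :
    CoinAlgorithm where
  N x := if h : ∃ n, firstTosses x n ∈ ⋃ b, c b then (Nat.find h : ℕ∞) else ⊤
  out x := decide (∃ n, firstTosses x n ∈ c true)
  N_eq n x y hxy hx := by
    have hL : ∀ {z : ℕ → Bool} {m k : ℕ}, firstTosses z m ∈ ⋃ b, c b →
        firstTosses z k ∈ ⋃ b, c b → m = k := by
      intro z m k hm hk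
      obtain ⟨a, ha⟩ := Set.mem_iUnion.1 hm
      obtain ⟨b, hb⟩ := Set.mem_iUnion.1 hk
      exact (hc.eq_of_firstTosses ha hb).2
    split_ifs at hx with h
    · have hn : Nat.find h = n := by exact_mod_cast hx
      have hy : firstTosses y n ∈ ⋃ b, c b := by
        rw [← firstTosses_congr hxy, ← hn]
        exact Nat.find_spec h
      have hy' : ∃ n, firstTosses y n ∈ ⋃ b, c b := ⟨n, hy⟩
      rw [dif_pos hy']
      exact_mod_cast hL (Nat.find_spec hy') hy
    · exact absurd hx (by simp)
  out_eq n x y hxy hx := by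
    split_ifs at hx with h
    · have hn : Nat.find h = n := by exact_mod_cast hx
      have hx' : firstTosses x n ∈ ⋃ b, c b := by
        rw [← hn]
        exact Nat.find_spec h
      obtain ⟨b, hb⟩ := Set.mem_iUnion.1 hx'
      have hby : firstTosses y n ∈ c b := by rwa [← firstTosses_congr hxy]
      rw [decide_eq_decide]
      constructor
      · rintro ⟨m, hm⟩
        obtain ⟨h1, -⟩ := hc.eq_of_firstTosses hm hby
        subst h1
        exact ⟨n, hb⟩
      · rintro ⟨m, hm⟩
        obtain ⟨h1, -⟩ := hc.eq_of_firstTosses hm hb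
        subst h1
        exact ⟨n, hby⟩
    · exact absurd hx (by simp)

lemma algorithmOf_N_ne_top {c : Bool → Set (List Bool)} (hc : PrefixFamily c) (x : ℕ → Bool) :
    (algorithmOf c hc).N x ≠ ⊤ ↔ ∃ n, firstTosses x n ∈ ⋃ b, c b := by
  simp only [algorithmOf]
  split_ifs with h
  · exact iff_of_true (by simp) h
  · exact iff_of_false (by simp) h

lemma algorithmOf_lt_N {c : Bool → Set (List Bool)} (hc : PrefixFamily c) {x : ℕ → Bool} {n : ℕ}
    (h : (n : ℕ∞) < (algorithmOf c hc).N x) (hx : ∃ n, firstTosses x n ∈ ⋃ b, c b) :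
    ∃ m, firstTosses x m ∈ {w | w ∈ ⋃ b, c b ∧ n < w.length} := by
  classical
  simp only [algorithmOf, dif_pos hx, Nat.cast_lt] at h
  exact ⟨Nat.find hx, Nat.find_spec hx, by simpa using h⟩

lemma gf_length_gt_le {x : Bool → ℝ≥0∞} {L : Set (List Bool)} {s : ℝ≥0∞} (hs : 1 ≤ s) (n : ℕ) :
    s ^ n * gf x {w | w ∈ L ∧ n < w.length} ≤ gf (fun a => s * x a) L := by
  calc s ^ n * gf x {w | w ∈ L ∧ n < w.length}
      = ∑' w : {w | w ∈ L ∧ n < w.length}, s ^ n * wordWeight x w.1 := ENNReal.tsum_mul_left.symm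
    _ ≤ ∑' w : {w | w ∈ L ∧ n < w.length}, wordWeight (fun a => s * x a) w.1 := by
        refine ENNReal.tsum_le_tsum fun w => ?_
        rw [wordWeight_mul]
        gcongr
        exact w.2.2.le
    _ ≤ gf (fun a => s * x a) L :=
        ENNReal.tsum_mono_subtype (wordWeight fun a => s * x a) fun w hw => hw.1

lemma FastOn.hasFastSimulation {f : ℝ → ℝ} {S : Set ℝ} (h : FastOn f S) :
    HasFastSimulation f S := by
  obtain ⟨c, hc, h⟩ := h
  have hL := hc.prefixFree_iUnion
  have hone : ∀ p : unitInterval, (p : ℝ) ∈ S → gf (coin p) (⋃ b, c b) = 1 := by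
    intro p hp
    obtain ⟨-, h2, h3, -⟩ := h p hp
    rw [gf_iUnion_bool _ hc, h3, h3, coin_true, coin_false,
      ← ENNReal.ofReal_add h2.1.le (by linarith [h2.2])]
    simp
  have hae : ∀ p : unitInterval, (p : ℝ) ∈ S →
      ∀ᵐ x ∂(coinLaw p), ∃ n, firstTosses x n ∈ ⋃ b, c b := by
    intro p hp
    have := (mem_ae_iff_prob_eq_one (μ := coinLaw p)
      (measurableSet_exists_firstTosses (⋃ b, c b))).2
      (by rw [coinLaw_exists_firstTosses p hL, hone p hp])
    exact this
  refine ⟨algorithmOf c hc, fun p hp => ⟨?_, ?_⟩, fun p hp => ?_⟩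
  · filter_upwards [hae p hp] with x hx
    exact (algorithmOf_N_ne_top hc x).2 hx
  · have hset : {x | (algorithmOf c hc).N x ≠ ⊤ ∧ (algorithmOf c hc).out x = true}
        = {x | ∃ n, firstTosses x n ∈ c true} := by
      ext x
      simp only [Set.mem_ofPred_eq, algorithmOf_N_ne_top]
      constructor
      · rintro ⟨-, h⟩
        simpa [algorithmOf] using h
      · intro h
        refine ⟨?_, by simpa [algorithmOf] using h⟩
        obtain ⟨n, hn⟩ := h
        exact ⟨n, Set.mem_iUnion.2 ⟨true, hn⟩⟩
    obtain ⟨-, h2, h3, -⟩ := h p hp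
    rw [hset, measureReal_def, coinLaw_exists_firstTosses p (hc.prefixFree true), h3, coin_true,
      ENNReal.toReal_ofReal h2.1.le]
  · obtain ⟨-, -, -, s', hs', hfin⟩ := h p hp
    -- a finite exponent is needed to form the real number `1 / s`
    obtain ⟨s, hs, hss, hst⟩ : ∃ s : ℝ≥0∞, 1 < s ∧ s ≤ s' ∧ s ≠ ⊤ :=
      ⟨min s' 2, lt_min hs' (by norm_num), min_le_left _ _,
        ne_top_of_le_ne_top (by simp) (min_le_right _ _)⟩
    set K := gf (fun a => s * coin p a) (⋃ b, c b) with hK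
    have hKfin : K ≠ ⊤ := by
      have hmono : ∀ a, s * coin p a ≤ s' * coin p a := fun a => by gcongr
      rw [hK, gf_iUnion_bool _ hc]
      exact ENNReal.add_ne_top.2 ⟨ne_top_of_le_ne_top (hfin _) (gf_mono hmono _),
        ne_top_of_le_ne_top (hfin _) (gf_mono hmono _)⟩
    have hs1 : 1 < s.toReal := by
      rw [← ENNReal.toReal_one]
      exact (ENNReal.toReal_lt_toReal (by simp) hst).2 hs
    refine ⟨K.toReal + 1, 1 / s.toReal, by positivity, by positivity,
      by rw [div_lt_one (by linarith)]; exact hs1, fun n => ?_⟩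
    have hle : coinLaw p {x | (n : ℕ∞) < (algorithmOf c hc).N x}
        ≤ gf (coin p) {w | w ∈ ⋃ b, c b ∧ n < w.length} := by
      rw [← coinLaw_exists_firstTosses p fun u hu v hv huv => hL u hu.1 v hv.1 huv]
      refine measure_mono_ae ?_
      filter_upwards [hae p hp] with x hx hlt
      exact algorithmOf_lt_N hc hlt hx
    have hfinite : gf (coin p) {w | w ∈ ⋃ b, c b ∧ n < w.length} ≠ ⊤ := by
      refine ne_top_of_le_ne_top ENNReal.one_ne_top (le_trans ?_ (hone p hp).le)
      exact ENNReal.tsum_mono_subtype (wordWeight (coin p)) fun w hw => hw.1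
    have h1 := gf_length_gt_le (x := coin p) (L := ⋃ b, c b) hs.le n
    have h2 := ENNReal.toReal_mono hKfin h1
    rw [ENNReal.toReal_mul, ENNReal.toReal_pow] at h2
    have h3 : (coinLaw p).real {x | (n : ℕ∞) < (algorithmOf c hc).N x}
        ≤ (gf (coin p) {w | w ∈ ⋃ b, c b ∧ n < w.length}).toReal :=
      ENNReal.toReal_mono hfinite hle
    rw [one_div, inv_pow, ← div_eq_mul_inv, le_div_iff₀ (by positivity)]
    calc _ ≤ (gf (coin p) {w | w ∈ ⋃ b, c b ∧ n < w.length}).toReal * s.toReal ^ n := by gcongr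
      _ ≤ K.toReal := by rw [mul_comm]; exact h2
      _ ≤ K.toReal + 1 := by linarith

/-! ### Fast simulation implies analyticity -/

/-- The words after which the algorithm `A` stops. -/
def stopWords (A : CoinAlgorithm) : Set (List Bool) :=
  {w | A.N (fun i => w.getD i false) = w.length}

/-- The words after which the algorithm `A` stops and declares heads. -/
def headsWords (A : CoinAlgorithm) : Set (List Bool) :=
  {w | w ∈ stopWords A ∧ A.out (fun i => w.getD i false) = true}

lemma firstTosses_getD {x : ℕ → Bool} {n i : ℕ} (hi : i < n) :
    (firstTosses x n).getD i false = x i := by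
  simp [firstTosses, hi]

lemma firstTosses_mem_stopWords (A : CoinAlgorithm) (x : ℕ → Bool) (n : ℕ) :
    firstTosses x n ∈ stopWords A ↔ A.N x = n := by
  simp only [stopWords, Set.mem_ofPred_eq, length_firstTosses]
  exact ⟨A.N_eq n _ _ fun i hi => firstTosses_getD hi,
    A.N_eq n _ _ fun i hi => (firstTosses_getD hi).symm⟩

lemma firstTosses_mem_headsWords (A : CoinAlgorithm) (x : ℕ → Bool) (n : ℕ) :
    firstTosses x n ∈ headsWords A ↔ A.N x = n ∧ A.out x = true := by
  rw [headsWords, Set.mem_ofPred_eq, firstTosses_mem_stopWords]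
  refine and_congr_right fun h => ?_
  rw [A.out_eq n x _ (fun i hi => (firstTosses_getD hi).symm) h]

lemma prefixFree_stopWords (A : CoinAlgorithm) : PrefixFree (stopWords A) := by
  rintro u hu v hv ⟨z, rfl⟩
  have h : A.N (fun i => (u ++ z).getD i false) = u.length := by
    refine A.N_eq u.length _ _ (fun i hi => ?_) hu
    exact (List.getD_append _ _ _ _ hi).symm
  have hv' : A.N (fun i => (u ++ z).getD i false) = (u ++ z).length := hv
  rw [h] at hv'
  have h2 : u.length = (u ++ z).length := by exact_mod_cast hv'
  have h3 : z = [] := by simpa using h2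
  simp [h3]

lemma prefixFree_headsWords (A : CoinAlgorithm) : PrefixFree (headsWords A) :=
  fun u hu v hv h => prefixFree_stopWords A u hu.1 v hv.1 h

lemma simulates_gf {A : CoinAlgorithm} {f : ℝ → ℝ} {S : Set ℝ} (hA : A.Simulates f S)
    {p : unitInterval} (hp : (p : ℝ) ∈ S) : (gf (coin p) (headsWords A)).toReal = f p := by
  rw [← (hA p hp).2, measureReal_def, ← coinLaw_exists_firstTosses p (prefixFree_headsWords A)]
  congr 2
  ext x
  simp only [firstTosses_mem_headsWords, Set.mem_ofPred_eq, ENat.ne_top_iff_exists]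
  constructor
  · rintro ⟨n, h1, h2⟩
    exact ⟨⟨n, h1.symm⟩, h2⟩
  · rintro ⟨⟨n, h1⟩, h2⟩
    exact ⟨n, h1.symm, h2⟩

/-- Exponential tails make the generating function of the stopping words converge beyond the weights
of the coin. -/
lemma exists_gf_stopWords_ne_top {A : CoinAlgorithm} {p : unitInterval} {C ρ : ℝ} (hC : 0 < C)
    (hρ0 : 0 ≤ ρ) (hρ1 : ρ < 1)
    (h : ∀ n : ℕ, (coinLaw p).real {x | (n : ℕ∞) < A.N x} ≤ C * ρ ^ n) :
    ∃ κ : ℝ, 1 < κ ∧ gf (fun a => ENNReal.ofReal κ * coin p a) (stopWords A) ≠ ⊤ := by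
  obtain ⟨κ, hκ, hκρ⟩ := exists_sq_mul_lt_one hρ0 hρ1
  have hκ0 : 0 < κ := by linarith
  have hκρ' : κ * ρ < 1 := by nlinarith [mul_nonneg hκ0.le hρ0]
  refine ⟨κ, hκ, ?_⟩
  have hsum : gf (fun a => ENNReal.ofReal κ * coin p a) (stopWords A)
      = ∑' n, gf (coin p) {w | w ∈ stopWords A ∧ w.length = n} * ENNReal.ofReal κ ^ n := by
    rw [← tsum_by_statistic List.length, gf]
    refine tsum_congr fun w => ?_
    rw [wordWeight_mul, mul_comm]
  have hprob : ∀ n, gf (coin p) {w | w ∈ stopWords A ∧ w.length = n}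
      = coinLaw p {x | A.N x = n} := by
    intro n
    rw [← coinLaw_exists_firstTosses p fun u hu v hv huv =>
      prefixFree_stopWords A u hu.1 v hv.1 huv]
    congr 1
    ext x
    simp only [Set.mem_ofPred_eq, length_firstTosses, firstTosses_mem_stopWords]
    constructor
    · rintro ⟨m, h1, rfl⟩
      exact h1
    · intro h1
      exact ⟨n, h1, rfl⟩
  rw [hsum, tsum_eq_zero_add' ENNReal.summable]
  refine ENNReal.add_ne_top.2 ⟨?_, ?_⟩
  · rw [hprob, pow_zero, mul_one]
    exact measure_ne_top _ _
  · refine ne_top_of_le_ne_top (b := ∑' n : ℕ, ENNReal.ofReal (C * κ) * ENNReal.ofReal (κ * ρ) ^ n)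
      ?_ (ENNReal.tsum_le_tsum fun n => ?_)
    · rw [ENNReal.tsum_mul_left, ENNReal.tsum_geometric]
      refine ENNReal.mul_ne_top ENNReal.ofReal_ne_top (ENNReal.inv_ne_top.2 ?_)
      have : ENNReal.ofReal (κ * ρ) < 1 := by simpa using hκρ'
      exact (tsub_pos_of_lt this).ne'
    · have h1 : coinLaw p {x | A.N x = (n + 1 : ℕ)} ≤ ENNReal.ofReal (C * ρ ^ n) := by
        refine le_trans (measure_mono fun x hx => ?_)
          ((ENNReal.le_ofReal_iff_toReal_le (measure_ne_top _ {x | (n : ℕ∞) < A.N x})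
            (by positivity)).2 (h n))
        have hx' : A.N x = (n + 1 : ℕ) := hx
        rw [Set.mem_ofPred_eq, hx']
        exact_mod_cast Nat.lt_succ_self n
      rw [hprob]
      refine (mul_le_mul_left h1 _).trans (le_of_eq ?_)
      rw [← ENNReal.ofReal_pow hκ0.le, ← ENNReal.ofReal_pow (by positivity),
        ← ENNReal.ofReal_mul (by positivity), ← ENNReal.ofReal_mul (by positivity)]
      congr 1
      ring

/-- The probability of a word as a function of a complex parameter. -/
noncomputable def complexWeight (w : List Bool) (z : ℂ) : ℂ :=
  (w.map fun b => if b then z else 1 - z).prod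

lemma differentiable_complexWeight (w : List Bool) : Differentiable ℂ (complexWeight w) := by
  unfold complexWeight
  induction w with
  | nil => simp
  | cons b w ih =>
    simp only [List.map_cons, List.prod_cons]
    refine Differentiable.mul ?_ ih
    cases b
    · simp only [Bool.false_eq_true, if_false]
      fun_prop
    · simp

lemma complexWeight_ofReal {p : ℝ} (h0 : 0 ≤ p) (h1 : p ≤ 1) (w : List Bool) :
    complexWeight w p = ((wordWeight (coin p) w).toReal : ℂ) := by
  unfold complexWeight
  induction w with
  | nil => simp
  | cons b w ih =>
    rw [List.map_cons, List.prod_cons, ih, wordWeight_cons, ENNReal.toReal_mul]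
    cases b
    · simp [ENNReal.toReal_ofReal (sub_nonneg.2 h1)]
    · simp [ENNReal.toReal_ofReal h0]

lemma wordWeight_coin_ne_top (p : ℝ) (w : List Bool) : wordWeight (coin p) w ≠ ⊤ := by
  induction w with
  | nil => simp
  | cons b w ih =>
    rw [wordWeight_cons]
    exact ENNReal.mul_ne_top (coin_ne_top p b) ih

lemma norm_complexWeight_le {p κ : ℝ} {z : ℂ} (h0 : 0 ≤ p) (h1 : p ≤ 1) (hκ : 0 ≤ κ)
    (hz0 : ‖z‖ ≤ κ * p) (hz1 : ‖1 - z‖ ≤ κ * (1 - p)) (w : List Bool) :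
    ‖complexWeight w z‖ ≤ (wordWeight (fun a => ENNReal.ofReal κ * coin p a) w).toReal := by
  unfold complexWeight
  induction w with
  | nil => simp
  | cons b w ih =>
    rw [List.map_cons, List.prod_cons, norm_mul, wordWeight_cons, ENNReal.toReal_mul]
    gcongr
    cases b
    · simpa [ENNReal.toReal_mul, ENNReal.toReal_ofReal hκ, ENNReal.toReal_ofReal (sub_nonneg.2 h1)]
        using hz1
    · simpa [ENNReal.toReal_mul, ENNReal.toReal_ofReal hκ, ENNReal.toReal_ofReal h0] using hz0

/-- Near a point of an open set on which `f` has a fast simulation, the expansion of `f` as a sum of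
probabilities of words converges uniformly in a complex neighbourhood. -/
theorem analyticOnNhd_of_hasFastSimulation {S : Set ℝ} {f : ℝ → ℝ} (hS : S ⊆ Set.Icc 0 1)
    (hf : HasFastSimulation f S) {U : Set ℝ} (hU : IsOpen U) (hUS : U ⊆ S) :
    AnalyticOnNhd ℝ f U := by
  intro p hp
  have hUI : U ⊆ Set.Ioo 0 1 := by
    rw [← interior_Icc]
    exact interior_maximal (hUS.trans hS) hU
  obtain ⟨A, hA, htail⟩ := hf
  obtain ⟨C, ρ, hC, hρ0, hρ1, h⟩ := htail ⟨p, hS (hUS hp)⟩ (hUS hp)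
  obtain ⟨κ, hκ, hfin⟩ := exists_gf_stopWords_ne_top hC hρ0 hρ1 h
  have hp0 : 0 < p := (hUI hp).1
  have hp1 : 0 < 1 - p := by linarith [(hUI hp).2]
  have hκ0 : 0 < κ := by linarith
  set V : Set ℂ := {z | ‖z‖ < κ * p ∧ ‖1 - z‖ < κ * (1 - p)} with hV
  have hVo : IsOpen V := by
    have h1 : IsOpen {z : ℂ | ‖z‖ < κ * p} := isOpen_lt (by fun_prop) (by fun_prop)
    have h2 : IsOpen {z : ℂ | ‖1 - z‖ < κ * (1 - p)} := isOpen_lt (by fun_prop) (by fun_prop)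
    exact h1.inter h2
  have hpV : (p : ℂ) ∈ V := by
    have h1 : ‖(1 - p : ℂ)‖ = 1 - p := by
      rw [← Complex.ofReal_one, ← Complex.ofReal_sub, Complex.norm_real, Real.norm_of_nonneg hp1.le]
    refine ⟨?_, ?_⟩
    · rw [Complex.norm_real, Real.norm_of_nonneg hp0.le]
      nlinarith
    · rw [h1]
      nlinarith
  set F : ℂ → ℂ := fun z => ∑' w : headsWords A, complexWeight w.1 z with hF
  have hsummable : Summable fun w : headsWords A =>
      (wordWeight (fun a => ENNReal.ofReal κ * coin p a) w.1).toReal := by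
    refine ENNReal.summable_toReal (ne_top_of_le_ne_top hfin ?_)
    exact ENNReal.tsum_mono_subtype (wordWeight fun a => ENNReal.ofReal κ * coin p a)
      fun w hw => hw.1
  have hFd : DifferentiableOn ℂ F V :=
    Complex.differentiableOn_tsum_of_summable_norm hsummable
      (fun w => (differentiable_complexWeight w.1).differentiableOn) hVo fun w z hz =>
        norm_complexWeight_le hp0.le (hUI hp).2.le hκ0.le hz.1.le hz.2.le w.1
  have hFa : AnalyticAt ℂ F p := hFd.analyticAt (hVo.mem_nhds hpV)
  have hre : AnalyticAt ℝ (fun x : ℝ => (F x).re) p := hFa.re_ofReal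
  refine hre.congr ?_
  filter_upwards [hU.mem_nhds hp] with q hq
  have hq0 : 0 ≤ q := (hUI hq).1.le
  have hq1 : q ≤ 1 := (hUI hq).2.le
  have h1 := simulates_gf hA (p := ⟨q, hS (hUS hq)⟩) (hUS hq)
  rw [← h1, hF]
  simp only [complexWeight_ofReal hq0 hq1]
  rw [← Complex.ofReal_tsum, Complex.ofReal_re, gf, ENNReal.tsum_toReal_eq]
  intro w
  exact wordWeight_coin_ne_top q w.1

/-! ### Power series and Möbius changes of the coin -/

/-- After an affine normalization, an absolutely convergent power series can be simulated. -/
lemma exists_fastOn_powerSeries {A : ℕ → ℝ} (hA : Summable fun n => |A n|) :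
    ∃ M : ℝ, 0 < M ∧ FastOn (fun x => (∑' n, A n * x ^ n + M) / (2 * M)) (Set.Ioo 0 1) := by
  set B := ∑' n, |A n| with hB
  have hB0 : 0 ≤ B := tsum_nonneg fun n => abs_nonneg _
  have hP : ∀ n, |∑ j ∈ Finset.range (n + 1), A j| ≤ B := fun n =>
    (Finset.abs_sum_le_sum_abs _ _).trans (hA.sum_le_tsum _ fun i _ => abs_nonneg _)
  refine ⟨B + 1, by linarith, ?_⟩
  refine fastOn_of_hasSum_runs
    (θ := fun n => (∑ j ∈ Finset.range (n + 1), A j + (B + 1)) / (2 * (B + 1))) (fun n => ?_)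
    fun x hx => ?_
  · have h1 := abs_le.1 (hP n)
    refine ⟨div_nonneg (by linarith [h1.1]) (by linarith), ?_⟩
    rw [div_le_one (by linarith)]
    linarith [h1.2]
  · have hx0 := hx.1.le
    have hterm : ∀ n, |A n * x ^ n| ≤ |A n| := by
      intro n
      rw [abs_mul, abs_of_nonneg (pow_nonneg hx0 n)]
      exact mul_le_of_le_one_right (abs_nonneg _) (pow_le_one₀ hx0 hx.2.le)
    have hsum : Summable fun n => A n * x ^ n := Summable.of_norm_bounded hA hterm
    have habs : |∑' n, A n * x ^ n| ≤ B := by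
      have h1 : Summable fun n => ‖A n * x ^ n‖ := hsum.norm
      exact (norm_tsum_le_tsum_norm h1).trans (h1.tsum_le_tsum hterm hA)
    have h2 := abs_le.1 habs
    refine ⟨hx, ⟨div_pos (by linarith [h2.1]) (by linarith), ?_⟩, ?_⟩
    · rw [div_lt_one (by linarith)]
      linarith [h2.2]
    · have h3 := hasSum_partialSums hx0 hx.2 hP hsum.hasSum
      have hx1 : 1 - x ≠ 0 := by linarith [hx.2]
      have h4 := (hasSum_geometric_of_lt_one hx0 hx.2).mul_left ((B + 1) * (1 - x))
      refine hasSum_of_eq ((h3.add h4).div_const (2 * (B + 1))) (fun n => ?_) ?_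
      · ring
      · rw [mul_assoc, mul_inv_cancel₀ hx1, mul_one]

/-- Raising the odds of a coin to a power of two. -/
lemma FastOn.pow_odds {v : ℝ → ℝ} {S : Set ℝ} (hv : FastOn v S) (j : ℕ) :
    FastOn (fun p => v p ^ 2 ^ j / (v p ^ 2 ^ j + (1 - v p) ^ 2 ^ j)) S := by
  induction j with
  | zero =>
    refine hv.congr fun p hp => ?_
    simp
  | succ j ih =>
    refine (fastOn_sq_odds.comp ih fun p hp => ih.mem_Ioo hp).congr fun p hp => ?_
    obtain ⟨h0, h1⟩ := hv.mem_Ioo hp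
    have hX : 0 < v p ^ 2 ^ j := by positivity
    have hY : 0 < (1 - v p) ^ 2 ^ j := pow_pos (by linarith) _
    rw [pow_succ, pow_mul, pow_mul]
    set X := v p ^ 2 ^ j
    set Y := (1 - v p) ^ 2 ^ j
    have h2 : 1 - X / (X + Y) = Y / (X + Y) := by
      field_simp
      ring
    rw [h2]
    field_simp

/-! ### Holomorphic extension from an interval -/

/-- A real power series converges in a complex disc. -/
lemma exists_local_complex_extension {f : ℝ → ℝ} {s : Set ℝ} {x : ℝ}
    (hf : AnalyticWithinAt ℝ f s x) :
    ∃ (r : ℝ) (G : ℂ → ℂ), 0 < r ∧ DifferentiableOn ℂ G (Metric.ball (x : ℂ) r) ∧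
      ∀ y ∈ insert x s, |y - x| < r → G y = f y := by
  obtain ⟨g, -, hfg, p, R, hR⟩ := analyticWithinAt_iff_exists_analyticAt'.1 hf
  obtain ⟨r, hr0, hrR⟩ := ENNReal.lt_iff_exists_nnreal_btwn.1 hR.r_pos
  have hr0' : (0 : ℝ) < r := by exact_mod_cast hr0
  have hsum := p.summable_norm_mul_pow (hrR.trans_le hR.r_le)
  have hle : ∀ n : ℕ, ∀ z ∈ Metric.ball (x : ℂ) r,
      ‖(p.coeff n : ℂ) * (z - x) ^ n‖ ≤ ‖p n‖ * (r : ℝ) ^ n := by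
    intro n z hz
    rw [norm_mul, norm_pow, Complex.norm_real, p.norm_apply_eq_norm_coef]
    have : ‖z - x‖ ≤ r := by
      rw [Metric.mem_ball, dist_eq_norm] at hz
      exact hz.le
    gcongr
  refine ⟨r, fun z => ∑' n : ℕ, (p.coeff n : ℂ) * (z - x) ^ n, hr0', ?_, ?_⟩
  · exact Complex.differentiableOn_tsum_of_summable_norm hsum (fun n => by fun_prop)
      Metric.isOpen_ball hle
  · intro y hy hyr
    have hyR : y - x ∈ Metric.eball (0 : ℝ) R := by
      rw [Metric.mem_eball, edist_zero_right]
      refine lt_trans ?_ hrR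
      rw [← ofReal_norm, Real.norm_eq_abs, ← ENNReal.ofReal_coe_nnreal]
      exact (ENNReal.ofReal_lt_ofReal_iff hr0').2 hyr
    have h1 := hR.hasSum hyR
    simp only [p.apply_eq_pow_smul_coeff, smul_eq_mul, add_sub_cancel] at h1
    rw [hfg hy, ← h1.tsum_eq, Complex.ofReal_tsum]
    refine tsum_congr fun n => ?_
    push_cast
    ring

lemma frequently_mem_Icc {a b t : ℝ} (hab : a < b) (ht : t ∈ Set.Icc a b) :
    ∃ᶠ y in nhdsWithin t {t}ᶜ, y ∈ Set.Icc a b := by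
  rcases ht.2.lt_or_eq with h | rfl
  · have : ∀ᶠ y in nhdsWithin t (Set.Ioi t), y ∈ Set.Icc a b := by
      filter_upwards [Ioc_mem_nhdsGT h] with y hy
      exact ⟨ht.1.trans hy.1.le, hy.2⟩
    exact this.frequently.filter_mono (nhdsWithin_mono t fun y hy => ne_of_gt hy)
  · have : ∀ᶠ y in nhdsWithin t (Set.Iio t), y ∈ Set.Icc a t := by
      filter_upwards [Ico_mem_nhdsLT hab] with y hy
      exact ⟨hy.1, hy.2.le⟩
    exact this.frequently.filter_mono (nhdsWithin_mono t fun y hy => ne_of_lt hy)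

/-- The local extensions agree by the identity theorem, since the intersection of two overlapping discs
centred at points of the interval contains a point of the interval. -/
lemma exists_complex_extension {a b : ℝ} (hab : a < b) {f : ℝ → ℝ}
    (hf : AnalyticOn ℝ f (Set.Icc a b)) :
    ∃ (W : Set ℂ) (F : ℂ → ℂ), IsOpen W ∧ (∀ x ∈ Set.Icc a b, (x : ℂ) ∈ W) ∧
      DifferentiableOn ℂ F W ∧ ∀ x ∈ Set.Icc a b, F x = f x := by
  classical
  have hloc : ∀ x : Set.Icc a b, ∃ (r : ℝ) (G : ℂ → ℂ), 0 < r ∧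
      DifferentiableOn ℂ G (Metric.ball ((x : ℝ) : ℂ) r) ∧
      ∀ y ∈ Set.Icc a b, |y - x| < r → G y = f y := by
    intro x
    obtain ⟨r, G, hr, hG, hGf⟩ := exists_local_complex_extension (hf x.1 x.2)
    exact ⟨r, G, hr, hG, fun y hy => hGf y (Set.mem_insert_of_mem _ hy)⟩
  choose r G hr hG hGf using hloc
  have hagree : ∀ (x y : Set.Icc a b) (z : ℂ), z ∈ Metric.ball ((x : ℝ) : ℂ) (r x) →
      z ∈ Metric.ball ((y : ℝ) : ℂ) (r y) → G x z = G y z := by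
    intro x y z hzx hzy
    set D := Metric.ball ((x : ℝ) : ℂ) (r x) ∩ Metric.ball ((y : ℝ) : ℂ) (r y) with hD
    have hDo : IsOpen D := Metric.isOpen_ball.inter Metric.isOpen_ball
    have hDc : IsPreconnected D := ((convex_ball _ _).inter (convex_ball _ _)).isPreconnected
    have hrx := hr x
    have hry := hr y
    have hxy : |(y : ℝ) - x| < r x + r y := by
      have h1 : dist ((y : ℝ) : ℂ) ((x : ℝ) : ℂ) < r x + r y := by
        calc _ ≤ dist z ((y : ℝ) : ℂ) + dist z ((x : ℝ) : ℂ) := dist_triangle_left _ _ _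
          _ < r x + r y := by
            rw [Metric.mem_ball] at hzx hzy
            linarith
      rwa [dist_eq_norm, ← Complex.ofReal_sub, Complex.norm_real, Real.norm_eq_abs] at h1
    set t : ℝ := (r y * x + r x * y) / (r x + r y) with ht
    have htx : t - x = r x * (((y : ℝ) - x) / (r x + r y)) := by
      rw [ht]
      field_simp
      ring
    have hty : t - y = -(r y * (((y : ℝ) - x) / (r x + r y))) := by
      rw [ht]
      field_simp
      ring
    have hq : |((y : ℝ) - x) / (r x + r y)| < 1 := by
      rw [abs_div, abs_of_pos (add_pos hrx hry), div_lt_one (add_pos hrx hry)]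
      exact hxy
    have htx' : |t - x| < r x := by
      rw [htx, abs_mul, abs_of_pos hrx]
      exact mul_lt_of_lt_one_right hrx hq
    have hty' : |t - y| < r y := by
      rw [hty, abs_neg, abs_mul, abs_of_pos hry]
      exact mul_lt_of_lt_one_right hry hq
    have htI : t ∈ Set.Icc a b := by
      have hx := x.2
      have hy := y.2
      rw [ht]
      constructor
      · rw [le_div_iff₀ (add_pos hrx hry)]
        nlinarith [mul_le_mul_of_nonneg_left hx.1 hry.le, mul_le_mul_of_nonneg_left hy.1 hrx.le]
      · rw [div_le_iff₀ (add_pos hrx hry)]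
        nlinarith [mul_le_mul_of_nonneg_left hx.2 hry.le, mul_le_mul_of_nonneg_left hy.2 hrx.le]
    have htD : (t : ℂ) ∈ D := by
      constructor
      · rwa [Metric.mem_ball, dist_eq_norm, ← Complex.ofReal_sub, Complex.norm_real]
      · rwa [Metric.mem_ball, dist_eq_norm, ← Complex.ofReal_sub, Complex.norm_real]
    have hGx : AnalyticOnNhd ℂ (G x) D := ((hG x).mono Set.inter_subset_left).analyticOnNhd hDo
    have hGy : AnalyticOnNhd ℂ (G y) D := ((hG y).mono Set.inter_subset_right).analyticOnNhd hDo
    have hfreq : ∃ᶠ z in nhdsWithin (t : ℂ) {(t : ℂ)}ᶜ, G x z = G y z := by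
      have htend : Filter.Tendsto (fun u : ℝ => (u : ℂ)) (nhdsWithin t {t}ᶜ)
          (nhdsWithin (t : ℂ) {(t : ℂ)}ᶜ) := by
        refine tendsto_nhdsWithin_iff.2 ⟨?_, ?_⟩
        · exact (Complex.continuous_ofReal.tendsto t).mono_left nhdsWithin_le_nhds
        · filter_upwards [self_mem_nhdsWithin] with u hu
          simpa using hu
      refine htend.frequently ?_
      have hev : ∀ᶠ u in nhdsWithin t {t}ᶜ, |u - (x : ℝ)| < r x ∧ |u - (y : ℝ)| < r y := by
        refine Filter.Eventually.filter_mono nhdsWithin_le_nhds ?_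
        have c1 : ContinuousAt (fun u : ℝ => |u - x|) t := by fun_prop
        have c2 : ContinuousAt (fun u : ℝ => |u - y|) t := by fun_prop
        exact (c1.eventually_lt continuousAt_const htx').and
          (c2.eventually_lt continuousAt_const hty')
      refine ((frequently_mem_Icc hab htI).and_eventually hev).mono ?_
      rintro u ⟨hu, hux, huy⟩
      rw [hGf x u hu hux, hGf y u hu huy]
    exact hGx.eqOn_of_preconnected_of_frequently_eq hGy hDc htD hfreq ⟨hzx, hzy⟩
  set W : Set ℂ := ⋃ x : Set.Icc a b, Metric.ball ((x : ℝ) : ℂ) (r x) with hW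
  set F : ℂ → ℂ := fun z =>
    if h : ∃ x : Set.Icc a b, z ∈ Metric.ball ((x : ℝ) : ℂ) (r x) then G h.choose z else 0 with hF
  have hFG : ∀ (x : Set.Icc a b) (z : ℂ), z ∈ Metric.ball ((x : ℝ) : ℂ) (r x) → F z = G x z := by
    intro x z hz
    have h : ∃ x : Set.Icc a b, z ∈ Metric.ball ((x : ℝ) : ℂ) (r x) := ⟨x, hz⟩
    simp only [hF, dif_pos h]
    exact hagree _ _ z h.choose_spec hz
  refine ⟨W, F, isOpen_iUnion fun x => Metric.isOpen_ball, fun x hx => ?_, fun z hz => ?_,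
    fun x hx => ?_⟩
  · exact Set.mem_iUnion.2 ⟨⟨x, hx⟩, Metric.mem_ball_self (hr _)⟩
  · obtain ⟨x, hx⟩ := Set.mem_iUnion.1 hz
    have hnhds := Metric.isOpen_ball.mem_nhds hx
    have h1 : DifferentiableAt ℂ (G x) z := (hG x).differentiableAt hnhds
    refine (h1.congr_of_eventuallyEq ?_).differentiableWithinAt
    filter_upwards [hnhds] with u hu
    exact hFG x u hu
  · rw [hFG ⟨x, hx⟩ x (Metric.mem_ball_self (hr _))]
    exact hGf ⟨x, hx⟩ x hx (by simpa using hr ⟨x, hx⟩)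

/-! ### Lenses around an interval -/

/-- The conformal map of the right half-plane onto a lens with tips `α` and `β`: the inverse of
`z ↦ ((z - α) / (β - z)) ^ k`. -/
noncomputable def lensMap (α β : ℝ) (k : ℕ) (w : ℂ) : ℂ :=
  (α + β * Complex.exp (Complex.log w / k)) / (1 + Complex.exp (Complex.log w / k))

lemma re_exp_log_div_pos {k : ℕ} (hk : 1 ≤ k) {w : ℂ} (hw : 0 < w.re) :
    0 < (Complex.exp (Complex.log w / k)).re := by
  have hk' : (1 : ℝ) ≤ k := by exact_mod_cast hk
  have harg : |w.arg| < Real.pi / 2 := Complex.abs_arg_lt_pi_div_two_iff.2 (Or.inl hw)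
  have him : (Complex.log w / k).im = w.arg / k := by
    rw [Complex.div_natCast_im, Complex.log_im]
  rw [Complex.exp_re, him]
  refine mul_pos (Real.exp_pos _) (Real.cos_pos_of_mem_Ioo ?_)
  rw [Set.mem_Ioo, ← abs_lt, abs_div, Nat.abs_cast]
  exact (div_le_self (abs_nonneg _) hk').trans_lt harg

lemma norm_one_add_ge {ζ : ℂ} (h : 0 < ζ.re) : 1 ≤ ‖1 + ζ‖ := by
  have h1 := Complex.abs_re_le_norm (1 + ζ)
  have h2 : (1 + ζ).re = 1 + ζ.re := by simp
  rw [h2, abs_of_pos (by linarith)] at h1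
  linarith

/-- The lens is thin if `k` is large. -/
lemma exists_dist_lensMap_le {α β : ℝ} (hαβ : α ≤ β) {k : ℕ} (hk : 1 ≤ k) {w : ℂ}
    (hw : 0 < w.re) :
    ∃ x ∈ Set.Icc α β, dist (lensMap α β k w) x ≤ (β - α) * (Real.pi / 2) / k := by
  have hk' : (0 : ℝ) < k := by exact_mod_cast hk
  set ζ := Complex.exp (Complex.log w / k) with hζ
  have hre : 0 < ζ.re := re_exp_log_div_pos hk hw
  set r := Real.exp (Real.log ‖w‖ / k) with hr
  have hr0 : 0 < r := Real.exp_pos _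
  have hζr : ζ = r * Complex.exp (Complex.I * (w.arg / k : ℝ)) := by
    rw [hζ, hr, Complex.ofReal_exp, ← Complex.exp_add]
    congr 1
    rw [Complex.log]
    push_cast
    ring
  have hdist : ‖ζ - r‖ ≤ r * (Real.pi / 2 / k) := by
    have h1 : ζ - r = r * (Complex.exp (Complex.I * (w.arg / k : ℝ)) - 1) := by
      rw [hζr]
      ring
    rw [h1, norm_mul, Complex.norm_real, Real.norm_of_nonneg hr0.le]
    refine mul_le_mul_of_nonneg_left ?_ hr0.le
    refine (Real.norm_exp_I_mul_ofReal_sub_one_le).trans ?_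
    rw [Real.norm_eq_abs, abs_div, Nat.abs_cast]
    exact div_le_div_of_nonneg_right (Complex.abs_arg_le_pi_div_two_iff.2 hw.le) hk'.le
  have h1ζ : 1 + ζ ≠ 0 := by
    intro h
    have := norm_one_add_ge hre
    rw [h, norm_zero] at this
    linarith
  have h1r : (1 + r : ℂ) ≠ 0 := by
    have : (1 + r : ℝ) ≠ 0 := by positivity
    exact_mod_cast this
  refine ⟨(α + β * r) / (1 + r), ⟨?_, ?_⟩, ?_⟩
  · rw [le_div_iff₀ (by positivity)]
    nlinarith
  · rw [div_le_iff₀ (by positivity)]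
    nlinarith
  · have hdiff : lensMap α β k w - ((α + β * r) / (1 + r) : ℝ)
        = ((β - α : ℝ) : ℂ) * (ζ - r) / ((1 + ζ) * (1 + r)) := by
      rw [lensMap, ← hζ]
      push_cast
      field_simp
      ring
    rw [dist_eq_norm, hdiff, norm_div, norm_mul, norm_mul, Complex.norm_real,
      Real.norm_of_nonneg (sub_nonneg.2 hαβ)]
    have h2 : ‖(1 + r : ℂ)‖ = 1 + r := by
      have : (1 + r : ℂ) = ((1 + r : ℝ) : ℂ) := by push_cast; ring
      rw [this, Complex.norm_real, Real.norm_of_nonneg (by positivity)]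
    have h3 : r ≤ ‖1 + ζ‖ * ‖(1 + r : ℂ)‖ := by
      rw [h2]
      nlinarith [norm_one_add_ge hre]
    have h4 : 0 < ‖1 + ζ‖ * ‖(1 + r : ℂ)‖ := hr0.trans_le h3
    rw [div_le_iff₀ h4]
    have h5 : 0 ≤ (β - α) * (Real.pi / 2) / k :=
      div_nonneg (mul_nonneg (sub_nonneg.2 hαβ) (by positivity)) hk'.le
    calc (β - α) * ‖ζ - r‖ ≤ (β - α) * (r * (Real.pi / 2 / k)) :=
          mul_le_mul_of_nonneg_left hdist (sub_nonneg.2 hαβ)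
      _ = (β - α) * (Real.pi / 2) / k * r := by ring
      _ ≤ _ := mul_le_mul_of_nonneg_left h3 h5

/-- Every neighbourhood of an interval contains a lens around the interval. -/
lemma exists_lens {a b : ℝ} (hab : a ≤ b) {W : Set ℂ} (hW : IsOpen W)
    (hIW : ∀ x ∈ Set.Icc a b, (x : ℂ) ∈ W) :
    ∃ (α β : ℝ) (j : ℕ), α < a ∧ b < β ∧
      ∀ w : ℂ, 0 < w.re → lensMap α β (2 ^ j) w ∈ W := by
  have hcomp : IsCompact ((fun x : ℝ => (x : ℂ)) '' Set.Icc a b) :=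
    isCompact_Icc.image Complex.continuous_ofReal
  obtain ⟨δ, hδ, hsub⟩ := hcomp.exists_thickening_subset_open hW
    (by rintro _ ⟨x, hx, rfl⟩; exact hIW x hx)
  set α := a - δ / 2 with hα
  set β := b + δ / 2 with hβ
  have hαβ : α ≤ β := by linarith
  obtain ⟨j, hj⟩ := pow_unbounded_of_one_lt ((β - α) * (Real.pi / 2) / (δ / 2)) one_lt_two
  refine ⟨α, β, j, by linarith, by linarith, fun w hw => hsub ?_⟩
  obtain ⟨x, hx, hd⟩ := exists_dist_lensMap_le hαβ (Nat.one_le_two_pow (n := j)) hw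
  have hd' : dist (lensMap α β (2 ^ j) w) x < δ / 2 := by
    refine hd.trans_lt ?_
    rw [div_lt_iff₀ (by positivity)] at hj ⊢
    push_cast
    linarith
  -- the point of `[a, b]` closest to `x`
  set x' := max a (min x b) with hx'
  have hx'I : x' ∈ Set.Icc a b := ⟨le_max_left _ _, max_le hab (min_le_right _ _)⟩
  have hxx' : |x - x'| ≤ δ / 2 := by
    rw [abs_le]
    have h1 := hx.1
    have h2 := hx.2
    rcases le_total x b with h | h <;> rcases le_total a x with h' | h'
    · rw [hx', min_eq_left h, max_eq_right h']
      constructor <;> linarith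
    · rw [hx', min_eq_left h, max_eq_left h']
      constructor <;> linarith
    · rw [hx', min_eq_right h, max_eq_right hab]
      constructor <;> linarith
    · rw [hx', min_eq_right h, max_eq_right hab]
      constructor <;> linarith
  rw [Metric.mem_thickening_iff]
  refine ⟨(x' : ℂ), ⟨x', hx'I, rfl⟩, ?_⟩
  have h3 : dist (x : ℂ) (x' : ℂ) ≤ δ / 2 := by
    rwa [dist_eq_norm, ← Complex.ofReal_sub, Complex.norm_real]
  calc dist (lensMap α β (2 ^ j) w) x'
      ≤ dist (lensMap α β (2 ^ j) w) x + dist (x : ℂ) x' := dist_triangle _ _ _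
    _ < δ / 2 + δ / 2 := add_lt_add_of_lt_of_le hd' h3
    _ = δ := by ring

lemma lensMap_odds {α β v : ℝ} (hv0 : 0 < v) (hv1 : v < 1) {k : ℕ} (hk : k ≠ 0) :
    lensMap α β k ((v ^ k / (1 - v) ^ k : ℝ) : ℂ) = ((α + (β - α) * v : ℝ) : ℂ) := by
  have h1 : 0 < 1 - v := by linarith
  have hexp : Complex.exp (Complex.log ((v ^ k / (1 - v) ^ k : ℝ) : ℂ) / k)
      = ((v / (1 - v) : ℝ) : ℂ) := by
    rw [← div_pow, ← Complex.ofReal_log (by positivity), Real.log_pow]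
    push_cast
    rw [mul_div_cancel_left₀ _ (by exact_mod_cast hk)]
    rw [← Complex.ofReal_exp, Real.exp_log (by positivity)]
    push_cast
    ring
  rw [lensMap, hexp, ← Complex.ofReal_mul, ← Complex.ofReal_add, ← Complex.ofReal_one,
    ← Complex.ofReal_add, ← Complex.ofReal_div]
  congr 1
  field_simp
  ring

/-- The Cayley transform maps the disc to the right half-plane. -/
lemma re_cayley_pos {c : ℝ} (hc : 0 < c) {s : ℂ} (hs : ‖s‖ < 1) :
    0 < ((1 + s) / (1 - s) / c).re := by
  have h1 : 1 - s ≠ 0 := by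
    intro h
    have : s = 1 := (sub_eq_zero.1 h).symm
    rw [this, norm_one] at hs
    exact lt_irrefl _ hs
  have hsq : s.re * s.re + s.im * s.im < 1 := by
    rw [← Complex.normSq_apply, Complex.normSq_eq_norm_sq]
    nlinarith [norm_nonneg s]
  have hpos : 0 < Complex.normSq (1 - s) := Complex.normSq_pos.2 h1
  rw [Complex.div_ofReal_re, Complex.div_re, ← add_div]
  refine div_pos (div_pos ?_ hpos) hc
  simp only [Complex.add_re, Complex.one_re, Complex.sub_re, Complex.add_im, Complex.one_im,
    Complex.sub_im]
  nlinarith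

lemma differentiableOn_lensMap_cayley (α β : ℝ) {k : ℕ} (hk : 1 ≤ k) {c : ℝ} (hc : 0 < c) :
    DifferentiableOn ℂ (fun s : ℂ => lensMap α β k ((1 + s) / (1 - s) / c))
      (Metric.ball 0 1) := by
  intro s hs
  have hs' : ‖s‖ < 1 := by simpa using hs
  have h1 : 1 - s ≠ 0 := by
    intro h
    have : s = 1 := (sub_eq_zero.1 h).symm
    rw [this, norm_one] at hs'
    exact lt_irrefl _ hs'
  have hw := re_cayley_pos hc hs'
  have hcay : DifferentiableAt ℂ (fun s : ℂ => (1 + s) / (1 - s) / c) s := by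
    refine DifferentiableAt.div_const (DifferentiableAt.div ?_ ?_ h1) _
    · fun_prop
    · fun_prop
  have hexp : DifferentiableAt ℂ
      (fun s : ℂ => Complex.exp (Complex.log ((1 + s) / (1 - s) / c) / k)) s :=
    ((hcay.clog (Or.inl hw)).div_const _).cexp
  have hne : 1 + Complex.exp (Complex.log ((1 + s) / (1 - s) / c) / k) ≠ 0 := by
    intro h
    have := norm_one_add_ge (re_exp_log_div_pos hk hw)
    rw [h, norm_zero] at this
    linarith
  refine DifferentiableAt.differentiableWithinAt ?_
  unfold lensMap
  exact DifferentiableAt.div ((differentiableAt_const _).add ((differentiableAt_const _).mul hexp))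
    ((differentiableAt_const _).add hexp) hne

/-! ### Analyticity implies fast simulation -/

/-- A continuous function with values in `(0, 1)` on a compact interval stays away from `0`
and `1`. -/
lemma exists_margin {a b : ℝ} (hab : a ≤ b) {f : ℝ → ℝ} (hf : ContinuousOn f (Set.Icc a b))
    (hfI : ∀ x ∈ Set.Icc a b, f x ∈ Set.Ioo (0 : ℝ) 1) :
    ∃ ε : ℝ, 0 < ε ∧ ∀ x ∈ Set.Icc a b, ε ≤ f x ∧ f x ≤ 1 - ε := by
  have hne : (Set.Icc a b).Nonempty := Set.nonempty_Icc.2 hab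
  obtain ⟨x, hx, hmin⟩ := isCompact_Icc.exists_isMinOn hne hf
  obtain ⟨y, hy, hmax⟩ := isCompact_Icc.exists_isMaxOn hne hf
  refine ⟨min (f x) (1 - f y), lt_min (hfI x hx).1 (by linarith [(hfI y hy).2]),
    fun z hz => ⟨(min_le_left _ _).trans (hmin hz), ?_⟩⟩
  have h1 : f z ≤ f y := hmax hz
  linarith [min_le_right (f x) (1 - f y)]

/-- The coordinate on the disc onto which the lens is mapped, restricted to the interval, and divided
by a number `σ < 1` such that it still takes values in `(0, 1)`, can be simulated. The factor `c` in
the odds moves the interval to the positive half of the diameter of the disc. -/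
lemma exists_fastOn_disc_coordinate {a b α β : ℝ} (h0 : 0 < a) (hab : a ≤ b) (h1 : b < 1)
    (hα : α < a) (hβ : b < β) (j : ℕ) :
    ∃ (c σ : ℝ) (y : ℝ → ℝ), 0 < c ∧ 0 < σ ∧ σ < 1 ∧ FastOn y (Set.Icc a b) ∧
      ∀ p ∈ Set.Icc a b, lensMap α β (2 ^ j)
        ((1 + ((σ * y p : ℝ) : ℂ)) / (1 - ((σ * y p : ℝ) : ℂ)) / c) = p := by
  have hαβ : 0 < β - α := by linarith
  set k := 2 ^ j with hk
  set v : ℝ → ℝ := fun p => (p - α) / (β - α) with hv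
  set v₀ := (a - α) / (β - α) with hv₀
  set v₁ := (β - b) / (β - α) with hv₁
  have hv₀0 : 0 < v₀ := div_pos (by linarith) hαβ
  have hv₁0 : 0 < v₁ := div_pos (by linarith) hαβ
  have hvl : ∀ p ∈ Set.Icc a b, v₀ ≤ v p := fun p hp =>
    div_le_div_of_nonneg_right (by linarith [hp.1]) hαβ.le
  have hvu : ∀ p ∈ Set.Icc a b, v₁ ≤ 1 - v p := by
    intro p hp
    have : 1 - v p = (β - p) / (β - α) := by
      simp only [hv]
      field_simp
      ring
    rw [this]
    exact div_le_div_of_nonneg_right (by linarith [hp.2]) hαβ.le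
  have hvfast : FastOn v (Set.Icc a b) := by
    refine (fastOn_id.mono fun p hp => ⟨h0.trans_le hp.1, hp.2.trans_lt h1⟩).affine
      (A := 1 / (β - α)) (B := -α / (β - α)) (ε := min v₀ v₁) (by positivity)
      (lt_min hv₀0 hv₁0) (fun p hp => ?_) (fun p hp => (min_le_left _ _).trans (hvl p hp))
      fun p hp => ?_
    · simp only [hv]
      ring
    · linarith [hvu p hp, min_le_right v₀ v₁]
  have hv₀1 : v₀ < 1 := by
    rw [hv₀, div_lt_one hαβ]
    linarith
  have hv₁1 : v₁ < 1 := by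
    rw [hv₁, div_lt_one hαβ]
    linarith
  have hX0 : 0 < v₀ ^ k := pow_pos hv₀0 k
  have hY0 : 0 < v₁ ^ k := pow_pos hv₁0 k
  have hX1 : v₀ ^ k ≤ 1 := pow_le_one₀ hv₀0.le hv₀1.le
  have hY1 : v₁ ^ k ≤ 1 := pow_le_one₀ hv₁0.le hv₁1.le
  set c := 2 / v₀ ^ k with hc
  have hc2 : 2 ≤ c := by
    rw [hc, le_div_iff₀ hX0]
    linarith
  have hcX : c * v₀ ^ k = 2 := by
    rw [hc]
    field_simp
  set η := 2 * v₁ ^ k / (c + 1) with hη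
  have hη0 : 0 < η := by positivity
  have hη1 : η < 1 := by
    rw [hη, div_lt_one (by linarith)]
    linarith
  set σ := 1 - η / 2 with hσ
  have hσ0 : 0 < σ := by linarith
  set X : ℝ → ℝ := fun p => v p ^ k with hXdef
  set Y : ℝ → ℝ := fun p => (1 - v p) ^ k with hYdef
  have hbounds : ∀ p ∈ Set.Icc a b, 2 ≤ c * X p ∧ X p ≤ 1 ∧ v₁ ^ k ≤ Y p ∧ Y p ≤ 1 := by
    intro p hp
    have e1 := hvl p hp
    have e2 := hvu p hp
    refine ⟨?_, pow_le_one₀ (by linarith) (by linarith), ?_, pow_le_one₀ (by linarith)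
      (by linarith)⟩
    · rw [← hcX]
      exact mul_le_mul_of_nonneg_left (pow_le_pow_left₀ hv₀0.le e1 k) (by linarith)
    · exact pow_le_pow_left₀ hv₁0.le e2 k
  have ht : FastOn (fun p => X p / (X p + Y p)) (Set.Icc a b) := hvfast.pow_odds j
  have ht' : FastOn (fun p => c * X p / (c * X p + Y p)) (Set.Icc a b) := by
    refine ((fastOn_mul_odds (c := c) (by linarith)).comp ht fun p hp => ht.mem_Ioo hp).congr
      fun p hp => ?_
    obtain ⟨e1, e2, e3, e4⟩ := hbounds p hp
    have hXp : 0 < X p := by nlinarith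
    have hYp : 0 < Y p := by linarith
    have e5 : 1 - X p / (X p + Y p) = Y p / (X p + Y p) := by
      field_simp
      ring
    rw [e5]
    field_simp
  have hu : ∀ p ∈ Set.Icc a b, 1 / 3 ≤ (c * X p - Y p) / (c * X p + Y p) ∧
      (c * X p - Y p) / (c * X p + Y p) ≤ 1 - η := by
    intro p hp
    obtain ⟨e1, e2, e3, e4⟩ := hbounds p hp
    have hYp : 0 < Y p := by linarith
    have hden : 0 < c * X p + Y p := by linarith
    refine ⟨?_, ?_⟩
    · rw [div_le_div_iff₀ (by norm_num) hden]
      linarith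
    · have e5 : (c * X p - Y p) / (c * X p + Y p) = 1 - 2 * Y p / (c * X p + Y p) := by
        field_simp
        ring
      have e6 : η ≤ 2 * Y p / (c * X p + Y p) := by
        rw [hη]
        refine div_le_div₀ (by positivity) (by linarith) hden ?_
        nlinarith
      linarith
  refine ⟨c, σ, fun p => (c * X p - Y p) / (c * X p + Y p) / σ, by linarith, hσ0, by linarith,
    ?_, fun p hp => ?_⟩
  · refine ht'.affine (A := 2 / σ) (B := -1 / σ) (ε := min (1 / 3) (η / 2)) (by positivity)
      (by positivity) (fun p hp => ?_) (fun p hp => ?_) fun p hp => ?_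
    · obtain ⟨e1, e2, e3, e4⟩ := hbounds p hp
      have hden : 0 < c * X p + Y p := by linarith
      field_simp
      ring
    · refine (min_le_left _ _).trans ?_
      rw [le_div_iff₀ hσ0]
      linarith [(hu p hp).1]
    · have e7 : (c * X p - Y p) / (c * X p + Y p) / σ ≤ 1 - η / 2 := by
        rw [div_le_iff₀ hσ0]
        nlinarith [(hu p hp).2]
      linarith [min_le_right (1 / 3 : ℝ) (η / 2)]
  · obtain ⟨e1, e2, e3, e4⟩ := hbounds p hp
    have hYp : 0 < Y p := by linarith
    have hden : 0 < c * X p + Y p := by linarith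
    have hc0 : 0 < c := by linarith
    have hmain : (1 + σ * ((c * X p - Y p) / (c * X p + Y p) / σ)) /
        (1 - σ * ((c * X p - Y p) / (c * X p + Y p) / σ)) / c = X p / Y p := by
      rw [mul_div_cancel₀ _ hσ0.ne']
      have e8 : 1 + (c * X p - Y p) / (c * X p + Y p) = 2 * (c * X p) / (c * X p + Y p) := by
        field_simp
        ring
      have e9 : 1 - (c * X p - Y p) / (c * X p + Y p) = 2 * Y p / (c * X p + Y p) := by
        field_simp
        ring
      rw [e8, e9]
      field_simp
    have hcast : (1 + ((σ * ((c * X p - Y p) / (c * X p + Y p) / σ) : ℝ) : ℂ)) /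
        (1 - ((σ * ((c * X p - Y p) / (c * X p + Y p) / σ) : ℝ) : ℂ)) / c
        = ((X p / Y p : ℝ) : ℂ) := by
      rw [← hmain]
      push_cast
      rfl
    rw [hcast, hXdef, hYdef, lensMap_odds (hv₀0.trans_le (hvl p hp))
      (by linarith [hvu p hp]) (by positivity)]
    congr 1
    change α + (β - α) * ((p - α) / (β - α)) = p
    field_simp
    ring

/-- A real analytic function on a nondegenerate interval is a power series in a coin: map a lens
in the domain of holomorphy conformally onto the unit disc. -/
lemma fastOn_of_analyticOn {a b : ℝ} (h0 : 0 < a) (hab : a < b) (h1 : b < 1) {f : ℝ → ℝ}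
    (hfI : ∀ x ∈ Set.Icc a b, f x ∈ Set.Ioo (0 : ℝ) 1) (hf : AnalyticOn ℝ f (Set.Icc a b)) :
    FastOn f (Set.Icc a b) := by
  obtain ⟨W, F, hW, hIW, hF, hFf⟩ := exists_complex_extension hab hf
  obtain ⟨α, β, j, hα, hβ, hlens⟩ := exists_lens hab.le hW hIW
  obtain ⟨c, σ, y, hc, hσ0, hσ1, hy, hlensy⟩ :=
    exists_fastOn_disc_coordinate h0 hab.le h1 hα hβ j
  set Φ : ℂ → ℂ := fun s => F (lensMap α β (2 ^ j) ((1 + s) / (1 - s) / c)) with hΦ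
  have hΦd : DifferentiableOn ℂ Φ (Metric.ball 0 1) :=
    hF.comp (differentiableOn_lensMap_cayley α β Nat.one_le_two_pow hc)
      fun s hs => hlens _ (re_cayley_pos hc (by simpa using hs))
  set t : ℕ → ℂ := fun n => (n.factorial : ℂ)⁻¹ * iteratedDeriv n Φ 0 with ht
  have hser : ∀ s : ℂ, ‖s‖ < 1 → HasSum (fun n => t n * s ^ n) (Φ s) := by
    intro s hs
    have := Complex.hasSum_taylorSeries_on_ball hΦd (z := s) (by simpa using hs)
    have hterms : (fun n => t n * s ^ n) =
        fun n : ℕ => (n.factorial : ℂ)⁻¹ • (s - 0) ^ n • iteratedDeriv n Φ 0 := by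
      funext n
      simp only [ht, smul_eq_mul, sub_zero]
      ring
    rwa [hterms]
  set A : ℕ → ℝ := fun n => (t n).re * σ ^ n with hA
  have hAsum : Summable fun n => |A n| := by
    have hσn : ‖(σ : ℂ)‖ < 1 := by rwa [Complex.norm_real, Real.norm_of_nonneg hσ0.le]
    refine Summable.of_nonneg_of_le (fun n => abs_nonneg _) (fun n => ?_) (hser σ hσn).summable.norm
    rw [hA, norm_mul, norm_pow, Complex.norm_real, Real.norm_of_nonneg hσ0.le, abs_mul,
      abs_of_nonneg (pow_nonneg hσ0.le n)]
    exact mul_le_mul_of_nonneg_right (Complex.abs_re_le_norm _) (pow_nonneg hσ0.le n)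
  obtain ⟨M, hM, hfast⟩ := exists_fastOn_powerSeries hAsum
  obtain ⟨ε, hε, hεf⟩ := exists_margin hab.le hf.continuousOn hfI
  refine (hfast.comp hy fun p hp => hy.mem_Ioo hp).affine (A := 2 * M) (B := -M) (by positivity) hε
    (fun p hp => ?_) (fun p hp => (hεf p hp).1) fun p hp => (hεf p hp).2
  have hyp := hy.mem_Ioo hp
  have hnorm : ‖((σ * y p : ℝ) : ℂ)‖ < 1 := by
    rw [Complex.norm_real, Real.norm_of_nonneg (mul_nonneg hσ0.le hyp.1.le)]
    nlinarith [hyp.1, hyp.2]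
  have hval : Φ ((σ * y p : ℝ) : ℂ) = f p := by
    simp only [hΦ]
    rw [hlensy p hp, hFf p hp]
  have hre := Complex.hasSum_re (hser _ hnorm)
  rw [hval, Complex.ofReal_re] at hre
  have hterm : ∀ n, A n * y p ^ n = (t n * ((σ * y p : ℝ) : ℂ) ^ n).re := by
    intro n
    rw [← Complex.ofReal_pow, Complex.re_mul_ofReal, mul_pow, hA]
    ring
  have hsum : ∑' n, A n * y p ^ n = f p := by
    simp only [hterm]
    exact hre.tsum_eq
  rw [hsum]
  field_simp
  ring

end CoinFactory

theorem theorem2 :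
    (∀ (a b : ℝ) (f : ℝ → ℝ), 0 < a → a ≤ b → b < 1 →
      (∀ x ∈ Set.Icc a b, f x ∈ Set.Ioo (0 : ℝ) 1) →
      AnalyticOn ℝ f (Set.Icc a b) →
      HasFastSimulation f (Set.Icc a b)) ∧
    (∀ (S : Set ℝ) (f : ℝ → ℝ), S ⊆ Set.Icc (0 : ℝ) 1 →
      HasFastSimulation f S →
      ∀ U : Set ℝ, IsOpen U → U ⊆ S → AnalyticOnNhd ℝ f U) := by
  refine ⟨fun a b f h0 hab h1 hfI hf => ?_, fun S f hS hf U hU hUS =>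
    CoinFactory.analyticOnNhd_of_hasFastSimulation hS hf hU hUS⟩
  rcases hab.lt_or_eq with hlt | rfl
  · exact (CoinFactory.fastOn_of_analyticOn h0 hlt h1 hfI hf).hasFastSimulation
  · -- on a single point every function is constant
    have hconst := CoinFactory.fastOn_const (hfI a (by simp))
    refine ((hconst.mono fun p hp => ?_).congr fun p hp => ?_).hasFastSimulation (S := Set.Icc a a)
    · exact ⟨h0.trans_le hp.1, hp.2.trans_lt h1⟩
    · rw [le_antisymm hp.2 hp.1]
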